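/- For a connected graph $G$ with $n$ vertices let $\delta$ and $\Delta$ be its minimum and maximum degree, let $\mu_1\ge\mu_2\ge\dots\ge\mu_n$ be the eigenvalues of its adjacency matrix, and let $\lambda=\max_{2\le i\le n}|\mu_i|$. A sequence $(G_n)_{n\ge 1}$ of connected graphs, where $G_n$ has $n$ vertices and parameters $\delta_n,\Delta_n,\lambda_n$, is called an expander sequence if $\Delta_n/\delta_n=1+o(1)$ and $\lambda_n=o(\Delta_n)$ as $n\to\infty$. Let $q\in(0,1]$. Consider the following protocols, which proceed in rounds and start with a single informed vertex $v$ of $G$. In every round of push, every informed vertex calls an independently and uniformly chosen neighbour, and the called vertex becomes informed if the transmission succeeds. In every round of pull, every uninformed vertex calls an independently and uniformly chosen neighbour, and if the called vertex was informed at the beginning of the round, then the caller becomes informed if the transmission succeeds. In every round of push&pull (pp), every vertex calls an independently and uniformly chosen neighbour, and if exactly one of the two vertices was informed at the beginning of the round, then the other one becomes informed if the transmission succeeds. Each transmission succeeds with probability $q$, independently of everything else, and all rounds are independent; informed vertices stay informed. For $\mathcal P\in\{push,pull,pp\}$ let $T_{\mathcal P}(G,v,q)$ be the number of rounds until all vertices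 of $G$ are informed. For $q\in(0,1)$ put $$c_{push}(q)=\frac1{\log(1+q)}+\frac1q,\qquad c_{pull}(q)=\frac1{\log(1+q)}-\frac1{\log(1-q)},\qquad c_{pp}(q)=\frac1{\log(1+2q)}+\frac1{q-\log(1-q)},$$ and $c_{\mathcal P}(1)=\lim_{q\uparrow1}c_{\mathcal P}(q)$, that is, $c_{push}(1)=\frac1{\log2}+1$, $c_{pull}(1)=\frac1{\log2}$, $c_{pp}(1)=\frac1{\log3}$. Theorem. Let $(G_n)_{n\ge1}$ be an expander sequence and let $q\in(0,1]$. Then, with probability $1-o(1)$ as $n\to\infty$, uniformly in the initially informed vertex $v$ of $G_n$, (a) $T_{push}(G_n,v,q)=c_{push}(q)\log n+o(\log n)$, (b) $T_{pull}(G_n,v,q)=c_{pull}(q)\log n+o(\log n)$, (c) $T_{pp}(G_n,v,q)=c_{pp}(q)\log n+o(\log n)$. That is, for each $\mathcal P\in\{push,pull,pp\}$ there is a function $g$ with $g(n)=o(\log n)$ such that $$\min_{v\in V(G_n)}\Pr\bigl[\,|T_{\mathcal P}(G_n,v,q)-c_{\mathcal P}(q)\log n|\le g(n)\,\bigr]\to1\quad\text{as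 } n\to\infty.$$ -/

import Mathlib

open MeasureTheory ProbabilityTheory Filter Asymptotics
open scoped Topology

namespace RumourSpreading

/-- The three broadcast protocols: *push*, *pull* and *push&pull*. -/
inductive Protocol
  | push
  | pull
  | pp

/-- The constants `c_push(q)`, `c_pull(q)`, `c_pp(q)`. For `q = 1` the value is the limit
`q → 1` from below of the formula for `q < 1`, see `tendsto_runtimeConst`. -/
noncomputable def runtimeConst : Protocol → ℝ → ℝ
  | .push, q => 1 / Real.log (1 + q) + 1 / q
  | .pull, q =>
      if q = 1 then 1 / Real.log 2
      else 1 / Real.log (1 + q) - 1 / Real.log (1 - q)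
  | .pp, q =>
      if q = 1 then 1 / Real.log 3
      else 1 / Real.log (1 + 2 * q) + 1 / (q - Real.log (1 - q))

theorem tendsto_runtimeConst (P : Protocol) :
    Tendsto (runtimeConst P) (𝓝[<] 1) (𝓝 (runtimeConst P 1)) := by
  have hlog : Tendsto (fun q : ℝ => Real.log (1 - q)) (𝓝[<] 1) atBot := by
    refine Real.tendsto_log_nhdsGT_zero.comp ?_
    refine tendsto_nhdsWithin_iff.2 ⟨?_, ?_⟩
    · have : Tendsto (fun q : ℝ => 1 - q) (𝓝 1) (𝓝 (1 - 1)) :=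
        (continuous_const.sub continuous_id).tendsto 1
      rw [sub_self] at this
      exact this.mono_left nhdsWithin_le_nhds
    · filter_upwards [self_mem_nhdsWithin] with q hq
      exact sub_pos.2 (Set.mem_Iio.1 hq)
  have hid : Tendsto (fun q : ℝ => q) (𝓝[<] 1) (𝓝 1) := tendsto_id.mono_left nhdsWithin_le_nhds
  have h2 : Tendsto (fun q : ℝ => 1 / Real.log (1 + q)) (𝓝[<] 1) (𝓝 (1 / Real.log 2)) := by
    have h : Tendsto (fun q : ℝ => 1 + q) (𝓝[<] 1) (𝓝 2) := by
      convert hid.const_add 1 using 2; norm_num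
    exact tendsto_const_nhds.div (h.log (by norm_num)) (Real.log_pos (by norm_num)).ne'
  have h3 : Tendsto (fun q : ℝ => 1 / Real.log (1 + 2 * q)) (𝓝[<] 1) (𝓝 (1 / Real.log 3)) := by
    have h : Tendsto (fun q : ℝ => 1 + 2 * q) (𝓝[<] 1) (𝓝 3) := by
      convert (hid.const_mul 2).const_add 1 using 2; norm_num
    exact tendsto_const_nhds.div (h.log (by norm_num)) (Real.log_pos (by norm_num)).ne'
  have hne : ∀ᶠ q : ℝ in 𝓝[<] 1, q ≠ 1 := by
    filter_upwards [self_mem_nhdsWithin] with q hq using ne_of_lt hq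
  cases P with
  | push =>
    have hone : Tendsto (fun q : ℝ => 1 / q) (𝓝[<] 1) (𝓝 (1 / 1)) :=
      tendsto_const_nhds.div hid one_ne_zero
    have h := h2.add hone
    rw [show runtimeConst .push 1 = 1 / Real.log 2 + 1 / 1 by
      simp only [runtimeConst]; norm_num]
    exact h
  | pull =>
    have hz : Tendsto (fun q : ℝ => 1 / Real.log (1 - q)) (𝓝[<] 1) (𝓝 0) := by
      simpa [Function.comp_def] using tendsto_inv_atBot_zero.comp hlog
    have := h2.sub hz
    rw [sub_zero] at this
    simp only [runtimeConst, if_true]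
    refine this.congr' ?_
    filter_upwards [hne] with q hq
    simp [runtimeConst, hq]
  | pp =>
    have hz : Tendsto (fun q : ℝ => 1 / (q - Real.log (1 - q))) (𝓝[<] 1) (𝓝 0) := by
      have hneg : Tendsto (fun q : ℝ => -Real.log (1 - q)) (𝓝[<] 1) atTop :=
        tendsto_neg_atBot_atTop.comp hlog
      have h := hid.add_atTop hneg
      have h' := tendsto_inv_atTop_zero.comp h
      simpa [Function.comp_def, sub_eq_add_neg] using h'
    have := h3.add hz
    rw [add_zero] at this
    simp only [runtimeConst, if_true]
    refine this.congr' ?_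
    filter_upwards [hne] with q hq
    simp [runtimeConst, hq]

section Graph

variable {V : Type*} [Fintype V] [DecidableEq V] (G : SimpleGraph V) [DecidableRel G.Adj]

/-- `λ = max_{2 ≤ i ≤ n} |μ_i|`, where `μ_1 ≥ μ_2 ≥ ... ≥ μ_n` are the eigenvalues of the
adjacency matrix, with multiplicity; here they are indexed from `0` in decreasing order, so the
index `0` is left out. For at most one vertex the value is `0`. -/
noncomputable def secondEigenvalue : ℝ :=
  ⨆ i : {i : Fin (Fintype.card V) // i.val ≠ 0},
    |(G.isHermitian_adjMatrix ℝ).eigenvalues₀ i.val|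

end Graph

/-- An expander sequence `(G_n)_{n ≥ 1}`: `G_n` is a connected graph on `n` vertices,
`Δ_n / δ_n = 1 + o(1)` and `λ_n = o(Δ_n)`. (The graph with index `0` plays no role.) -/
structure IsExpanderSequence (G : ∀ n : ℕ, SimpleGraph (Fin n)) [∀ n, DecidableRel (G n).Adj] :
    Prop where
  connected : ∀ n, 1 ≤ n → (G n).Connected
  degree_ratio :
    Tendsto (fun n => ((G n).maxDegree : ℝ) / ((G n).minDegree : ℝ)) atTop (𝓝 1)
  eigenvalue : (fun n => secondEigenvalue (G n)) =o[atTop] fun n => ((G n).maxDegree : ℝ)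

/-- What happens at every vertex in one round: `ω u = (w, b)` means that `u` calls `w` and `b`
says whether the message transmission along this call is successful. -/
abbrev Round (V : Type*) := V → V × Bool

section Dynamics

variable {V : Type*} [Fintype V] [DecidableEq V]

/-- The set of informed vertices after one round with calls `ω`, started from the informed
set `I`. In push, the informed vertices use their calls to inform the called vertex; in pull, the
uninformed vertices use theirs to get informed by the called vertex; push&pull does both. -/
def nextInformed : Protocol → Finset V → Round V → Finset V
  | .push, I, ω => I ∪ Finset.univ.filter (fun w => ∃ u ∈ I, ω u = (w, true))
  | .pull, I, ω => I ∪ Finset.univ.filter (fun u => (ω u).1 ∈ I ∧ (ω u).2 = true)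
  | .pp, I, ω => I ∪ Finset.univ.filter (fun w => ∃ u ∈ I, ω u = (w, true)) ∪
      Finset.univ.filter (fun u => (ω u).1 ∈ I ∧ (ω u).2 = true)

/-- The set of informed vertices after `t` rounds, if initially only `v` is informed. -/
def informed (P : Protocol) (v : V) (ω : ℕ → Round V) : ℕ → Finset V
  | 0 => {v}
  | t + 1 => nextInformed P (informed P v ω t) (ω t)

/-- The runtime: the number of rounds until all vertices are informed, `⊤` if this never
happens. -/
noncomputable def runtime (P : Protocol) (v : V) (ω : ℕ → Round V) : ℕ∞ :=
  ⨅ (t : ℕ) (_ : informed P v ω t = Finset.univ), (t : ℕ∞)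

variable (G : SimpleGraph V) [DecidableRel G.Adj]

/-- The law of the vertex called by `u`: uniform on the neighbours of `u` (an isolated vertex,
which exists in a connected graph only if there is no other vertex, calls itself). -/
noncomputable def neighbourLaw (u : V) : PMF V :=
  if h : (G.neighborFinset u).Nonempty then PMF.uniformOfFinset (G.neighborFinset u) h
  else PMF.pure u

variable [MeasurableSpace V]

/-- The law of one round: all vertices independently call a uniformly random neighbour, and
each transmission independently succeeds with probability `q`. -/
noncomputable def roundLaw (q : unitInterval) : Measure (Round V) :=
  Measure.pi fun u => (neighbourLaw G u).toMeasure.prod (bernoulliMeasure true false q)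

/-- The law of the whole process: the rounds are independent and identically distributed. -/
noncomputable def processLaw (q : unitInterval) : Measure (ℕ → Round V) :=
  Measure.infinitePi fun _ : ℕ => roundLaw G q

instance isProbabilityMeasure_roundLaw (q : unitInterval) :
    IsProbabilityMeasure (roundLaw G q) := by
  unfold roundLaw; infer_instance

instance isProbabilityMeasure_processLaw (q : unitInterval) :
    IsProbabilityMeasure (processLaw G q) := by
  unfold processLaw; infer_instance

end Dynamics

end RumourSpreading

namespace RumourSpreading

/-! All three protocols are handled at once by two numbers: `a = pushRate` and `b = pullRate`. Given
the informed set `I`, an uninformed `u` stays uninformed with probability `(1 - b |N(u) ∩ I| / deg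
u) ∏ (1 - a / deg w)`, the product running over the informed neighbours `w` of `u`. Two such events
are negatively correlated, because one call informs at most one new vertex. Hence the number of
uninformed vertices after a round has variance at most that of independent trials
(`stepMean_variance_le`), and Chebyshev applies.

Expansion enters only through `IsQuasirandom`: the degrees are large and almost equal, and the
second moment of `|N(u) ∩ S|` over `u` is close to its value in a random graph. It follows from the
spectral gap (`sum_card_inter_sq_le`). It shows that a small informed set grows in mean by a factor
of about `1 + c` with `c = a + b`, since few calls stay inside it, and that a small uninformed set
shrinks in mean by about `ρ = (1 - b) exp (-a)`. The runtime constant is `1 / log (1 + c) + 1 /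
(-log ρ)` (`runtimeConst_eq`).

Upper bound: (i) Reaching a fixed small density of informed vertices takes about `log n / log (1 +
c)` rounds. The mean growth is turned into a probability bound by the contraction of a negative
moment of `|I|` (`stepMean_startPotential_le`). (ii) From a fixed density to almost all vertices,
the uninformed set contracts geometrically in mean, so an arbitrarily small multiple of `log n`
suffices. (iii) The rest takes about `log n / (-log ρ)` rounds, by Markov's inequality.

Lower bound: `E|I_t|` is at most about `(1 + c)^t`, so by Markov half of the vertices are still
uninformed shortly before `log n / log (1 + c)` rounds. After that the uninformed set hardly ever
shrinks by more than a factor slightly below `ρ`, by Chebyshev in every round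
(`iterate_stepMean_eq_univ_le`).

The process is studied through the one-round operator `stepMean`: probabilities after `t` rounds are
iterates of it, and composing iterates chains the phases. -/

/-- The success probability of a call made by an informed vertex. -/
def pushRate : Protocol → ℝ → ℝ
  | .push, q => q
  | .pull, _ => 0
  | .pp, q => q

/-- The success probability of a call made by an uninformed vertex. -/
def pullRate : Protocol → ℝ → ℝ
  | .push, _ => 0
  | .pull, q => q
  | .pp, q => q

/-! ### One round of the protocol: staying probabilities, mean and variance. -/

section OneRound

set_option linter.unusedSectionVars false

variable {V : Type*} [Fintype V] [DecidableEq V]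

/-- If `I` is the set of informed vertices and `u` is uninformed, then `u` becomes informed iff
some `w` successfully calls a vertex of `callTargets P I w u`. -/
def callTargets (P : Protocol) (I : Finset V) (w u : V) : Finset V :=
  match P with
  | .push => if w ∈ I then {u} else ∅
  | .pull => if w = u then I else ∅
  | .pp => if w = u then I else if w ∈ I then {u} else ∅

theorem subset_nextInformed (P : Protocol) (I : Finset V) (r : Round V) :
    I ⊆ nextInformed P I r := by
  intro x hx
  cases P <;> simp [nextInformed, hx]

theorem notMem_nextInformed_iff (P : Protocol) {I : Finset V} {u : V} (hu : u ∉ I) (r : Round V) :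
    u ∉ nextInformed P I r ↔ ∀ w, ¬ ((r w).1 ∈ callTargets P I w u ∧ (r w).2 = true) := by
  cases P with
  | push =>
    simp only [nextInformed, callTargets, Finset.mem_union, hu, false_or, Finset.mem_filter,
      Finset.mem_univ, true_and, not_exists, not_and]
    refine forall_congr' fun w => ?_
    by_cases hw : w ∈ I <;> simp [hw, Prod.ext_iff]
  | pull =>
    simp only [nextInformed, callTargets, Finset.mem_union, hu, false_or, Finset.mem_filter,
      Finset.mem_univ, true_and]
    constructor
    · intro h w
      by_cases hw : w = u
      · subst hw; simpa using h
      · simp [hw]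
    · intro h
      simpa using h u
  | pp =>
    simp only [nextInformed, callTargets, Finset.mem_union, hu, false_or, Finset.mem_filter,
      Finset.mem_univ, true_and, not_or, not_exists, not_and]
    constructor
    · rintro ⟨h1, h2⟩ w
      by_cases hw : w = u
      · subst hw; simpa using h2
      · by_cases hwI : w ∈ I
        · simpa [hw, hwI, Prod.ext_iff] using h1 w hwI
        · simp [hw, hwI]
    · intro h
      refine ⟨fun w hwI => ?_, by simpa using h u⟩
      have hw : w ≠ u := fun e => hu (e ▸ hwI)
      simpa [hw, hwI, Prod.ext_iff] using h w

/-- One call informs at most one new vertex: a caller in `I` can only inform the vertex it calls,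
and a caller outside `I` only itself. This is the source of the negative correlation. -/
theorem disjoint_callTargets (P : Protocol) {I : Finset V} {u v : V} (huv : u ≠ v)
    (hu : u ∉ I) (hv : v ∉ I) (w : V) :
    Disjoint (callTargets P I w u) (callTargets P I w v) := by
  rw [Finset.disjoint_left]
  intro x
  cases P <;> simp only [callTargets] <;> split_ifs <;> simp_all

variable (G : SimpleGraph V) [DecidableRel G.Adj] [MeasurableSpace V] [MeasurableSingletonClass V]

theorem neighbourLaw_real {w : V} (hw : 0 < G.degree w) (S : Finset V) :
    (neighbourLaw G w).toMeasure.real (S : Set V) =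
      ((G.neighborFinset w ∩ S).card : ℝ) / G.degree w := by
  have h : (G.neighborFinset w).Nonempty := by
    rw [← Finset.card_pos]; simpa using hw
  rw [neighbourLaw, dif_pos h, measureReal_def,
    PMF.toMeasure_uniformOfFinset_apply _ _ S.measurableSet, ENNReal.toReal_div]
  simp only [ENNReal.toReal_natCast, SimpleGraph.card_neighborFinset_eq_degree]
  congr 3
  ext x
  simp

theorem callLaw_real (q : unitInterval) {w : V} (hw : 0 < G.degree w) (S : Finset V) :
    ((neighbourLaw G w).toMeasure.prod (bernoulliMeasure true false q)).real
      {x | ¬ (x.1 ∈ S ∧ x.2 = true)} =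
      1 - q * ((G.neighborFinset w ∩ S).card : ℝ) / G.degree w := by
  have : {x : V × Bool | ¬ (x.1 ∈ S ∧ x.2 = true)} = ((S : Set V) ×ˢ {true})ᶜ := by
    ext x; simp
  rw [this, probReal_compl_eq_one_sub (Set.toFinite _).measurableSet, measureReal_prod_prod,
    neighbourLaw_real G hw,
    bernoulliMeasure_real_apply_of_mem_of_notMem q (by simp) (by simp) (by simp)]
  ring

theorem roundLaw_real (q : unitInterval) (hG : ∀ w, 0 < G.degree w) (S : V → Finset V) :
    (roundLaw G q).real {r | ∀ w, ¬ ((r w).1 ∈ S w ∧ (r w).2 = true)} =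
      ∏ w, (1 - q * ((G.neighborFinset w ∩ S w).card : ℝ) / G.degree w) := by
  have : {r : Round V | ∀ w, ¬ ((r w).1 ∈ S w ∧ (r w).2 = true)} =
      Set.univ.pi fun w => {x | ¬ (x.1 ∈ S w ∧ x.2 = true)} := by
    ext r; simp
  rw [this, roundLaw, measureReal_def, Measure.pi_pi, ENNReal.toReal_prod]
  exact Finset.prod_congr rfl fun w _ => callLaw_real G q (hG w) (S w)

/-- The probability that an uninformed vertex `u` stays uninformed in one round. -/
noncomputable def stayProb (P : Protocol) (q : ℝ) (I : Finset V) (u : V) : ℝ :=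
  (1 - pullRate P q * (G.neighborFinset u ∩ I).card / G.degree u) *
    ∏ w ∈ G.neighborFinset u ∩ I, (1 - pushRate P q / G.degree w)

/-- Every factor is `1` except those of `u` itself (its pull call) and of the informed vertices `w`
with `u` among their neighbours (their push calls), which by symmetry are the informed neighbours of
`u`. -/
theorem prod_callTargets (P : Protocol) (q : ℝ) {I : Finset V} {u : V} (hu : u ∉ I) :
    ∏ w, (1 - q * ((G.neighborFinset w ∩ callTargets P I w u).card : ℝ) / G.degree w) =
      stayProb G P q I u := by
  have hpush : ∏ w, (1 - q * ((G.neighborFinset w ∩ if w ∈ I then {u} else ∅).card : ℝ) /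
      G.degree w) = ∏ w ∈ G.neighborFinset u ∩ I, (1 - q / G.degree w) := by
    rw [← Finset.prod_subset (Finset.subset_univ (G.neighborFinset u ∩ I))]
    · refine Finset.prod_congr rfl fun w hw => ?_
      rw [Finset.mem_inter, SimpleGraph.mem_neighborFinset] at hw
      have : G.neighborFinset w ∩ {u} = {u} := by
        rw [Finset.inter_eq_right]; simpa using hw.1.symm
      simp [hw.2, this]
    · intro w _ hw
      rw [Finset.mem_inter, SimpleGraph.mem_neighborFinset] at hw
      by_cases hwI : w ∈ I
      · have : G.neighborFinset w ∩ {u} = ∅ := by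
          ext x
          simp only [Finset.mem_inter, SimpleGraph.mem_neighborFinset, Finset.mem_singleton,
            Finset.notMem_empty, iff_false, not_and]
          rintro h rfl
          exact hw ⟨h.symm, hwI⟩
        simp [hwI, this]
      · simp [hwI]
  cases P with
  | push => simpa [stayProb, pullRate, pushRate, callTargets] using hpush
  | pull =>
    simp only [stayProb, pullRate, pushRate, callTargets]
    rw [Finset.prod_eq_single u]
    · simp
    · intro w _ hw; simp [hw]
    · simp
  | pp =>
    simp only [stayProb, pullRate, pushRate, callTargets]
    rw [← hpush, ← Finset.mul_prod_erase _ _ (Finset.mem_univ u),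
      ← Finset.mul_prod_erase (a := u) _ (fun w => 1 - q * ((G.neighborFinset w ∩
        if w ∈ I then {u} else ∅).card : ℝ) / G.degree w) (Finset.mem_univ u)]
    simp only [if_true, hu, if_false, Finset.inter_empty, Finset.card_empty, Nat.cast_zero,
      mul_zero, zero_div, sub_zero, one_mul]
    congr 1
    refine Finset.prod_congr rfl fun w hw => ?_
    rw [if_neg (Finset.ne_of_mem_erase hw)]

theorem roundLaw_real_stay (P : Protocol) (q : unitInterval) (hG : ∀ w, 0 < G.degree w)
    {I : Finset V} {u : V} (hu : u ∉ I) :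
    (roundLaw G q).real {r | u ∉ nextInformed P I r} = stayProb G P q I u := by
  simp_rw [notMem_nextInformed_iff P hu]
  rw [roundLaw_real G q hG, prod_callTargets G P q hu]

/-- Negative correlation. By disjointness of the targets, the factor of a caller is `1 - x - y` on
the left and `(1 - x) * (1 - y)` on the right. -/
theorem roundLaw_real_stay_stay_le (P : Protocol) (q : unitInterval) (hG : ∀ w, 0 < G.degree w)
    {I : Finset V} {u v : V} (huv : u ≠ v) (hu : u ∉ I) (hv : v ∉ I) :
    (roundLaw G q).real {r | u ∉ nextInformed P I r ∧ v ∉ nextInformed P I r} ≤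
      stayProb G P q I u * stayProb G P q I v := by
  have : {r | u ∉ nextInformed P I r ∧ v ∉ nextInformed P I r} =
      {r : Round V | ∀ w, ¬ ((r w).1 ∈ callTargets P I w u ∪ callTargets P I w v ∧
        (r w).2 = true)} := by
    ext r
    simp only [Set.mem_ofPred_eq, notMem_nextInformed_iff P hu, notMem_nextInformed_iff P hv,
      ← forall_and, Finset.mem_union]
    refine forall_congr' fun w => ?_
    tauto
  rw [this, roundLaw_real G q hG, ← prod_callTargets G P q hu, ← prod_callTargets G P q hv,
    ← Finset.prod_mul_distrib]
  have hd : ∀ w, (0 : ℝ) < G.degree w := fun w => by exact_mod_cast hG w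
  refine Finset.prod_le_prod (fun w _ => ?_) fun w _ => ?_
  · rw [sub_nonneg, div_le_one (hd w)]
    have h1 : ((G.neighborFinset w ∩ (callTargets P I w u ∪ callTargets P I w v)).card : ℝ) ≤
        G.degree w := by
      rw [← G.card_neighborFinset_eq_degree]
      exact_mod_cast Finset.card_le_card Finset.inter_subset_left
    have := q.2.2
    have := q.2.1
    nlinarith
  · rw [Finset.inter_union_distrib_left, Finset.card_union_of_disjoint
      ((disjoint_callTargets P huv hu hv w).mono Finset.inter_subset_right
        Finset.inter_subset_right)]
    set x : ℝ := ((G.neighborFinset w ∩ callTargets P I w u).card : ℝ)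
    set y : ℝ := ((G.neighborFinset w ∩ callTargets P I w v).card : ℝ)
    have hx : 0 ≤ q * x / G.degree w :=
      div_nonneg (mul_nonneg q.2.1 (Nat.cast_nonneg _)) (hd w).le
    have hy : 0 ≤ q * y / G.degree w :=
      div_nonneg (mul_nonneg q.2.1 (Nat.cast_nonneg _)) (hd w).le
    have : q * ((((G.neighborFinset w ∩ callTargets P I w u).card +
        (G.neighborFinset w ∩ callTargets P I w v).card : ℕ)) : ℝ) / G.degree w =
        q * x / G.degree w + q * y / G.degree w := by
      push_cast; ring
    rw [this]
    nlinarith [mul_nonneg hx hy]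

/-- The expectation of `F` evaluated at the informed set after one round started from `I`. -/
noncomputable def stepMean (P : Protocol) (q : unitInterval) (F : Finset V → ℝ) (I : Finset V) :
    ℝ :=
  ∫ r, F (nextInformed P I r) ∂roundLaw G q

variable {G} {P : Protocol} {q : unitInterval} {F F' : Finset V → ℝ} {I : Finset V}

theorem stepMean_mono (h : ∀ J, I ⊆ J → F J ≤ F' J) :
    stepMean G P q F I ≤ stepMean G P q F' I :=
  integral_mono Integrable.of_finite Integrable.of_finite
    fun r => h _ (subset_nextInformed P I r)

theorem stepMean_congr (h : ∀ J, I ⊆ J → F J = F' J) :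
    stepMean G P q F I = stepMean G P q F' I :=
  le_antisymm (stepMean_mono fun J hJ => (h J hJ).le) (stepMean_mono fun J hJ => (h J hJ).ge)

theorem stepMean_const (c : ℝ) : stepMean G P q (fun _ => c) I = c := by
  simp [stepMean]

theorem stepMean_add :
    stepMean G P q (fun J => F J + F' J) I = stepMean G P q F I + stepMean G P q F' I :=
  integral_add Integrable.of_finite Integrable.of_finite

theorem stepMean_sub :
    stepMean G P q (fun J => F J - F' J) I = stepMean G P q F I - stepMean G P q F' I :=
  integral_sub Integrable.of_finite Integrable.of_finite

theorem stepMean_const_mul (c : ℝ) :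
    stepMean G P q (fun J => c * F J) I = c * stepMean G P q F I :=
  integral_const_mul c _

theorem stepMean_sum {ι : Type*} (s : Finset ι) (f : ι → Finset V → ℝ) :
    stepMean G P q (fun J => ∑ i ∈ s, f i J) I = ∑ i ∈ s, stepMean G P q (f i) I :=
  integral_finsetSum s fun _ _ => Integrable.of_finite

theorem stepMean_ite (p : Finset V → Prop) [DecidablePred p] :
    stepMean G P q (fun J => if p J then 1 else 0) I =
      (roundLaw G q).real {r | p (nextInformed P I r)} := by
  rw [← integral_indicator_one (Set.toFinite _).measurableSet]
  refine integral_congr_ae (ae_of_all _ fun r => ?_)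
  simp [Set.indicator_apply]

variable (G P q I) in
/-- The expected number of uninformed vertices after one round started from `I`. -/
noncomputable def meanStay : ℝ := ∑ u ∈ Iᶜ, stayProb G P q I u

theorem card_compl_eq_sum_ite {J : Finset V} (h : I ⊆ J) :
    ((Jᶜ.card : ℕ) : ℝ) = ∑ u ∈ Iᶜ, if u ∉ J then 1 else 0 := by
  rw [Finset.sum_boole]
  congr 2
  ext x
  simp only [Finset.mem_compl, Finset.mem_filter]
  exact ⟨fun hx => ⟨fun hi => hx (h hi), hx⟩, fun hx => hx.2⟩

theorem stepMean_card_compl (hG : ∀ w, 0 < G.degree w) :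
    stepMean G P q (fun J => (Jᶜ.card : ℝ)) I = meanStay G P q I := by
  rw [stepMean_congr fun J hJ => card_compl_eq_sum_ite hJ, stepMean_sum]
  refine Finset.sum_congr rfl fun u hu => ?_
  rw [stepMean_ite, roundLaw_real_stay G P q hG (by simpa using hu)]

/-- The square is a sum over pairs. Off the diagonal negative correlation applies; on the diagonal
`p = p ^ 2 + p * (1 - p)`. -/
theorem stepMean_card_compl_sq_le (hG : ∀ w, 0 < G.degree w) :
    stepMean G P q (fun J => (Jᶜ.card : ℝ) ^ 2) I ≤ meanStay G P q I ^ 2 +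
      ∑ u ∈ Iᶜ, stayProb G P q I u * (1 - stayProb G P q I u) := by
  rw [stepMean_congr (F' := fun J => ∑ u ∈ Iᶜ, ∑ v ∈ Iᶜ, if u ∉ J ∧ v ∉ J then 1 else 0)]
  · rw [stepMean_sum, meanStay, sq, Finset.sum_mul_sum, ← Finset.sum_add_distrib]
    refine Finset.sum_le_sum fun u hu => ?_
    have hu' : u ∉ I := by simpa using hu
    rw [stepMean_sum, ← Finset.add_sum_erase _ _ hu,
      ← Finset.add_sum_erase (a := u) _ (fun v => stayProb G P q I u * stayProb G P q I v) hu]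
    have h1 : stepMean G P q (fun J => if u ∉ J ∧ u ∉ J then 1 else 0) I =
        stayProb G P q I u := by
      rw [stepMean_ite, ← roundLaw_real_stay G P q hG hu']
      simp
    have h2 : ∑ v ∈ Iᶜ.erase u, stepMean G P q (fun J => if u ∉ J ∧ v ∉ J then 1 else 0) I ≤
        ∑ v ∈ Iᶜ.erase u, stayProb G P q I u * stayProb G P q I v := by
      refine Finset.sum_le_sum fun v hv => ?_
      rw [stepMean_ite]
      refine roundLaw_real_stay_stay_le G P q hG (Finset.ne_of_mem_erase hv).symm hu' ?_
      simpa using Finset.mem_of_mem_erase hv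
    rw [h1]
    linarith
  · intro J hJ
    rw [card_compl_eq_sum_ite hJ, sq, Finset.sum_mul_sum]
    refine Finset.sum_congr rfl fun u _ => Finset.sum_congr rfl fun v _ => ?_
    by_cases h : u ∈ J <;> by_cases h' : v ∈ J <;> simp [h, h']

theorem stepMean_variance_le (hG : ∀ w, 0 < G.degree w) :
    stepMean G P q (fun J => ((Jᶜ.card : ℝ) - meanStay G P q I) ^ 2) I ≤
      ∑ u ∈ Iᶜ, stayProb G P q I u * (1 - stayProb G P q I u) := by
  have h : stepMean G P q (fun J => ((Jᶜ.card : ℝ) - meanStay G P q I) ^ 2) I =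
      stepMean G P q (fun J => (Jᶜ.card : ℝ) ^ 2) I -
        2 * meanStay G P q I * stepMean G P q (fun J => (Jᶜ.card : ℝ)) I +
        meanStay G P q I ^ 2 := by
    rw [← stepMean_const_mul, ← stepMean_sub, ← stepMean_const (G := G) (P := P) (q := q) (I := I)
      (meanStay G P q I ^ 2), ← stepMean_add]
    exact stepMean_congr fun J _ => by ring
  rw [h, stepMean_card_compl hG]
  have := stepMean_card_compl_sq_le (P := P) (q := q) (I := I) hG
  nlinarith

theorem stayProb_mem_Icc (hG : ∀ w, 0 < G.degree w) {u : V} (hu : u ∉ I) :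
    stayProb G P q I u ∈ Set.Icc 0 1 := by
  rw [← roundLaw_real_stay G P q hG hu]
  exact ⟨measureReal_nonneg, measureReal_le_one⟩

end OneRound

/-! ### From the spectral gap to quasirandomness. -/

section Spectral

set_option linter.unusedSectionVars false

variable {V : Type*} [Fintype V] [DecidableEq V] (G : SimpleGraph V) [DecidableRel G.Adj]

/-- A quantitative form of near-regularity and expansion: the degrees are large and agree up to a
factor `1 + η`, and the second moments of the sizes of `N(u) ∩ S` are at most those in a random
graph, up to an error `η`. -/
structure IsQuasirandom (η : ℝ) : Prop where
  minDegree_pos : 0 < G.minDegree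
  maxDegree_le : (G.maxDegree : ℝ) ≤ (1 + η) * G.minDegree
  one_le : 1 ≤ η * G.minDegree
  mixing : ∀ S : Finset V, ∑ u, ((G.neighborFinset u ∩ S).card : ℝ) ^ 2 ≤
    (G.minDegree : ℝ) ^ 2 * (S.card * (S.card / Fintype.card V + η))

theorem sum_sum_neighborFinset (f : V → ℝ) :
    ∑ u, ∑ w ∈ G.neighborFinset u, f w = ∑ w, G.degree w * f w := by
  have : ∀ u, ∑ w ∈ G.neighborFinset u, f w = ∑ w, if G.Adj u w then f w else 0 := by
    intro u
    rw [← Finset.sum_filter]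
    exact Finset.sum_congr (by ext; simp) fun _ _ => rfl
  simp_rw [this]
  rw [Finset.sum_comm]
  refine Finset.sum_congr rfl fun w _ => ?_
  rw [← Finset.sum_filter, Finset.sum_const, nsmul_eq_mul, ← G.card_neighborFinset_eq_degree]
  congr 3
  ext u
  simp [G.adj_comm]

/-- Cauchy–Schwarz in each row and double counting of edges. It bounds every eigenvalue by the
maximum degree. -/
theorem sum_mulVec_sq_le (x : V → ℝ) :
    ∑ u, ((G.adjMatrix ℝ).mulVec x u) ^ 2 ≤ (G.maxDegree : ℝ) ^ 2 * ∑ u, x u ^ 2 := by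
  have h1 : ∀ u, ((G.adjMatrix ℝ).mulVec x u) ^ 2 ≤
      G.maxDegree * ∑ w ∈ G.neighborFinset u, x w ^ 2 := by
    intro u
    rw [G.adjMatrix_mulVec_apply]
    refine sq_sum_le_card_mul_sum_sq.trans ?_
    gcongr
    rw [G.card_neighborFinset_eq_degree]
    exact G.degree_le_maxDegree u
  refine (Finset.sum_le_sum fun u _ => h1 u).trans ?_
  rw [← Finset.mul_sum, sum_sum_neighborFinset G fun w => x w ^ 2, sq, mul_assoc, Finset.mul_sum]
  rw [Finset.mul_sum, Finset.mul_sum]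
  refine Finset.sum_le_sum fun w _ => ?_
  gcongr
  exact G.degree_le_maxDegree w

/-- The coordinates of a vector with respect to an orthonormal basis of eigenvectors of the
adjacency matrix. -/
noncomputable def eigenCoord (x : V → ℝ) (i : V) : ℝ :=
  inner ℝ ((G.isHermitian_adjMatrix ℝ).eigenvectorBasis i) (WithLp.toLp 2 x)

theorem eigenCoord_eq_dotProduct (x : V → ℝ) (i : V) :
    eigenCoord G x i = x ⬝ᵥ ⇑((G.isHermitian_adjMatrix ℝ).eigenvectorBasis i) := by
  rw [eigenCoord, EuclideanSpace.inner_eq_star_dotProduct]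
  simp

theorem eigenCoord_mulVec (x : V → ℝ) (i : V) :
    eigenCoord G ((G.adjMatrix ℝ).mulVec x) i =
      (G.isHermitian_adjMatrix ℝ).eigenvalues i * eigenCoord G x i := by
  rw [eigenCoord_eq_dotProduct, eigenCoord_eq_dotProduct, dotProduct_comm,
    Matrix.dotProduct_mulVec, ← Matrix.mulVec_transpose, G.transpose_adjMatrix,
    (G.isHermitian_adjMatrix ℝ).mulVec_eigenvectorBasis, smul_dotProduct, smul_eq_mul,
    dotProduct_comm]

theorem sum_eigenCoord_mul (x y : V → ℝ) :
    ∑ i, eigenCoord G x i * eigenCoord G y i = ∑ u, x u * y u := by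
  have := (G.isHermitian_adjMatrix ℝ).eigenvectorBasis.sum_inner_mul_inner
    (WithLp.toLp 2 x) (WithLp.toLp 2 y)
  simp only [eigenCoord]
  rw [EuclideanSpace.inner_eq_star_dotProduct] at this
  simp only [dotProduct, Pi.star_apply, star_trivial] at this
  rw [← Finset.sum_congr rfl fun u _ => mul_comm (y u) (x u), ← this]
  exact Finset.sum_congr rfl fun i _ => by rw [real_inner_comm]

theorem sum_eigenCoord_sq (x : V → ℝ) : ∑ i, eigenCoord G x i ^ 2 = ∑ u, x u ^ 2 := by
  simpa [sq] using sum_eigenCoord_mul G x x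

theorem abs_eigenvalues_le_maxDegree (i : V) :
    |(G.isHermitian_adjMatrix ℝ).eigenvalues i| ≤ G.maxDegree := by
  have h := sum_mulVec_sq_le G ⇑((G.isHermitian_adjMatrix ℝ).eigenvectorBasis i)
  have hn : ∑ u, (G.isHermitian_adjMatrix ℝ).eigenvectorBasis i u ^ 2 = 1 := by
    rw [← EuclideanSpace.real_norm_sq_eq, OrthonormalBasis.norm_eq_one, one_pow]
  rw [(G.isHermitian_adjMatrix ℝ).mulVec_eigenvectorBasis] at h
  simp only [Pi.smul_apply, smul_eq_mul, mul_pow, ← Finset.mul_sum, hn, mul_one] at h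
  exact abs_le_of_sq_le_sq h (Nat.cast_nonneg _)

/-- `eigenvalues` is indexed by vertices through an equivalence with `Fin`; the exceptional `i₀` is
the vertex of index `0`, the only index that `secondEigenvalue` leaves out. -/
theorem exists_abs_eigenvalues_le [Nonempty V] :
    ∃ i₀, ∀ i ≠ i₀, |(G.isHermitian_adjMatrix ℝ).eigenvalues i| ≤ secondEigenvalue G := by
  let e : Fin (Fintype.card V) ≃ V := Fintype.equivOfCardEq (Fintype.card_fin _)
  refine ⟨e ⟨0, Fintype.card_pos⟩, fun i hi => ?_⟩
  have h0 : (e.symm i).val ≠ 0 := by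
    intro h
    refine hi ?_
    rw [← e.apply_symm_apply i]
    congr 1
    exact Fin.ext h
  exact le_ciSup (f := fun i : {i : Fin (Fintype.card V) // i.val ≠ 0} =>
    |(G.isHermitian_adjMatrix ℝ).eigenvalues₀ i.val|) (Set.finite_range _).bddAbove ⟨e.symm i, h0⟩

theorem secondEigenvalue_nonneg : 0 ≤ secondEigenvalue G :=
  Real.iSup_nonneg fun _ => abs_nonneg _

/-- The left side is `‖A 1_S‖²`, expanded in an eigenbasis. The leading direction has eigenvalue at
most `Δ` and is nearly parallel to the all-ones vector, so the coordinate of `1_S` along it has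
square about `|S|² / n`. The other directions contribute at most `λ² |S|`. The parameter `b`
measures the angle between the leading eigenvector and the all-ones vector. -/
theorem sum_card_inter_sq_le [Nonempty V] {b : ℝ} (hb : 0 ≤ b)
    (hlt : secondEigenvalue G < G.maxDegree)
    (hgap : (G.maxDegree : ℝ) - G.minDegree ≤ b ^ 2 * (G.maxDegree - secondEigenvalue G))
    (S : Finset V) :
    ∑ u, ((G.neighborFinset u ∩ S).card : ℝ) ^ 2 ≤
      (G.maxDegree : ℝ) ^ 2 * (S.card * (S.card / Fintype.card V + (2 * b + b ^ 2))) +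
        secondEigenvalue G ^ 2 * S.card := by
  obtain ⟨i₀, hi₀⟩ := exists_abs_eigenvalues_le G
  set lam := secondEigenvalue G
  have hlam : 0 ≤ lam := secondEigenvalue_nonneg G
  set D : ℝ := (G.maxDegree : ℝ)
  set d : ℝ := (G.minDegree : ℝ)
  set μ := (G.isHermitian_adjMatrix ℝ).eigenvalues
  set n : ℝ := (Fintype.card V : ℝ) with hn
  have hn0 : 0 < n := by simp [hn, Fintype.card_pos]
  set k : ℝ := (S.card : ℝ) with hk
  have hk0 : 0 ≤ k := Nat.cast_nonneg _
  have hkn : k ≤ n := Nat.cast_le.2 S.card_le_univ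
  have hD : ∀ i, |μ i| ≤ D := abs_eigenvalues_le_maxDegree G
  -- the all-ones vector is close to the leading eigenvector
  set o : V → ℝ := fun _ => 1 with ho
  set a := eigenCoord G o i₀
  have hoo : ∑ i, eigenCoord G o i ^ 2 = n := by
    rw [sum_eigenCoord_sq]; simp [ho, hn]
  have hAo : d * n ≤ ∑ i, μ i * eigenCoord G o i ^ 2 := by
    have h1 := sum_eigenCoord_mul G ((G.adjMatrix ℝ).mulVec o) o
    simp only [eigenCoord_mulVec] at h1
    have h2 : ∑ i, μ i * eigenCoord G o i ^ 2 = ∑ u, (G.degree u : ℝ) := by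
      rw [← Finset.sum_congr rfl fun i _ => show μ i * eigenCoord G o i * eigenCoord G o i =
        μ i * eigenCoord G o i ^ 2 by ring]
      rw [h1]
      refine Finset.sum_congr rfl fun u _ => ?_
      rw [G.adjMatrix_mulVec_apply]
      simp [ho]
    rw [h2, mul_comm, hn, ← nsmul_eq_mul]
    exact Finset.card_nsmul_le_sum _ _ _ fun u _ =>
      Nat.cast_le.2 (G.minDegree_le_degree u)
  -- The Rayleigh quotient of the all-ones vector is at least `d`, so `d n ≤ D a² + λ (n - a²)`:
  -- little mass lies off `i₀` because `D - d` is small compared with `D - λ`.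
  have ha : n - a ^ 2 ≤ b ^ 2 * n := by
    rw [← Finset.add_sum_erase _ _ (Finset.mem_univ i₀)] at hAo hoo
    have h1 : ∑ i ∈ Finset.univ.erase i₀, μ i * eigenCoord G o i ^ 2 ≤
        ∑ i ∈ Finset.univ.erase i₀, lam * eigenCoord G o i ^ 2 := by
      refine Finset.sum_le_sum fun i hi => ?_
      gcongr
      exact (le_abs_self _).trans (hi₀ i (Finset.ne_of_mem_erase hi))
    rw [← Finset.mul_sum] at h1
    have h2 : μ i₀ * a ^ 2 ≤ D * a ^ 2 := by
      gcongr
      exact (le_abs_self _).trans (hD i₀)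
    have h3 : (D - lam) * (n - a ^ 2) ≤ (D - lam) * (b ^ 2 * n) := by
      nlinarith
    exact le_of_mul_le_mul_left h3 (sub_pos.2 hlt)
  have han : a ^ 2 ≤ n := by
    rw [← hoo]
    exact Finset.single_le_sum (f := fun i => eigenCoord G o i ^ 2) (fun i _ => sq_nonneg _)
      (Finset.mem_univ i₀)
  -- the coordinate of the indicator function of `S` along the leading eigenvector
  set x : V → ℝ := fun u => if u ∈ S then 1 else 0 with hx
  have hxx : ∑ u, x u ^ 2 = k := by
    simp [hx, hk]
  set v : V → ℝ := ⇑((G.isHermitian_adjMatrix ℝ).eigenvectorBasis i₀)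
  have hv : ∑ u, v u ^ 2 = 1 := by
    rw [← EuclideanSpace.real_norm_sq_eq, OrthonormalBasis.norm_eq_one, one_pow]
  have hav : a = ∑ u, v u := by
    simp only [a, eigenCoord_eq_dotProduct, dotProduct, ho, one_mul, v]
  set y := eigenCoord G x i₀
  -- The eigenvector is split into its mean `a / n` and a fluctuation whose squared norm is `1 - a²
  -- / n ≤ b²`.
  have hy : y = a / n * k + ∑ u ∈ S, (v u - a / n) := by
    have : y = ∑ u ∈ S, v u := by
      simp only [y, eigenCoord_eq_dotProduct, dotProduct, hx, ite_mul, one_mul, zero_mul, v]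
      rw [← Finset.sum_filter]
      exact Finset.sum_congr (by ext; simp) fun _ _ => rfl
    rw [this, Finset.sum_sub_distrib, Finset.sum_const, nsmul_eq_mul]
    ring
  set z := ∑ u ∈ S, (v u - a / n)
  have hz : z ^ 2 ≤ k * b ^ 2 := by
    have h1 : z ^ 2 ≤ k * ∑ u ∈ S, (v u - a / n) ^ 2 := sq_sum_le_card_mul_sum_sq
    have h2 : ∑ u ∈ S, (v u - a / n) ^ 2 ≤ ∑ u, (v u - a / n) ^ 2 :=
      Finset.sum_le_sum_of_subset_of_nonneg (Finset.subset_univ _) fun _ _ _ => sq_nonneg _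
    have h3 : ∑ u, (v u - a / n) ^ 2 = 1 - a ^ 2 / n := by
      have : ∀ u, (v u - a / n) ^ 2 = v u ^ 2 - 2 * (a / n) * v u + (a / n) ^ 2 := fun u => by ring
      simp_rw [this]
      rw [Finset.sum_add_distrib, Finset.sum_sub_distrib, ← Finset.mul_sum, hv, ← hav,
        Finset.sum_const, nsmul_eq_mul, Finset.card_univ, ← hn]
      field_simp
      ring
    have h4 : 1 - a ^ 2 / n ≤ b ^ 2 := by
      rw [sub_le_comm, le_div_iff₀ hn0]; nlinarith
    exact h1.trans (mul_le_mul_of_nonneg_left (by linarith) hk0)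
  have hyle : y ^ 2 ≤ k * (k / n + (2 * b + b ^ 2)) := by
    have h1 : (a / n * k) ^ 2 ≤ k * (k / n) := by
      rw [show (a / n * k) ^ 2 = a ^ 2 * (k ^ 2 / n ^ 2) by ring,
        show k * (k / n) = n * (k ^ 2 / n ^ 2) by field_simp]
      gcongr
    have h2 : k * (k / n) ≤ k := mul_le_of_le_one_right hk0 ((div_le_one hn0).2 hkn)
    have h3 : (a / n * k) * z ≤ k * b := by
      refine le_of_abs_le (abs_le_of_sq_le_sq ?_ (mul_nonneg hk0 hb))
      rw [mul_pow _ z, show (k * b) ^ 2 = k * (k * b ^ 2) by ring]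
      exact mul_le_mul (h1.trans h2) hz (sq_nonneg _) hk0
    rw [hy]
    nlinarith
  have hleft : ∑ u, ((G.neighborFinset u ∩ S).card : ℝ) ^ 2 =
      ∑ i, μ i ^ 2 * eigenCoord G x i ^ 2 := by
    have := sum_eigenCoord_sq G ((G.adjMatrix ℝ).mulVec x)
    simp only [eigenCoord_mulVec, mul_pow] at this
    rw [this]
    refine Finset.sum_congr rfl fun u _ => ?_
    rw [G.adjMatrix_mulVec_apply]
    simp only [hx, Finset.sum_boole]
    congr 3
  have hx2 := sum_eigenCoord_sq G x
  rw [hxx] at hx2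
  rw [hleft, ← Finset.add_sum_erase _ _ (Finset.mem_univ i₀)]
  refine add_le_add ?_ ?_
  · refine mul_le_mul (sq_le_sq' ?_ ?_) hyle (sq_nonneg _) (sq_nonneg _)
    · exact (abs_le.1 (hD i₀)).1
    · exact (abs_le.1 (hD i₀)).2
  · rw [← hx2, Finset.mul_sum]
    refine (Finset.sum_le_sum fun i hi => ?_).trans (Finset.sum_le_sum_of_subset_of_nonneg
      (Finset.subset_univ (Finset.univ.erase i₀)) fun i _ _ => by positivity)
    have := abs_le.1 (hi₀ i (Finset.ne_of_mem_erase hi))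
    exact mul_le_mul_of_nonneg_right (sq_le_sq' this.1 this.2) (sq_nonneg _)

theorem sum_card_inter_singleton_sq (u : V) :
    ∑ w, ((G.neighborFinset w ∩ {u}).card : ℝ) ^ 2 = G.degree u := by
  have : ∀ w, ((G.neighborFinset w ∩ {u}).card : ℝ) ^ 2 =
      if w ∈ G.neighborFinset u then 1 else 0 := by
    intro w
    by_cases hw : w ∈ G.neighborFinset u
    · have : G.neighborFinset w ∩ {u} = {u} := by
        rw [Finset.inter_eq_right]; simpa [G.adj_comm] using hw
      simp [hw, this]
    · have : G.neighborFinset w ∩ {u} = ∅ := by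
        rw [Finset.inter_singleton_of_notMem]
        simpa [G.adj_comm] using hw
      simp [hw, this]
  simp_rw [this]
  rw [Finset.sum_boole, ← G.card_neighborFinset_eq_degree]
  congr 2
  ext; simp

/-- The degree gap is at most `θ² d` and `D - λ ≥ D / 2`, so the angle parameter may be `b = 2 θ`.
The constant `50` is generous. -/
theorem sum_card_inter_sq_le_of_secondEigenvalue_le [Nonempty V] {θ : ℝ} (hθ0 : 0 < θ)
    (hθ : 100 * θ ≤ 1) (hd0 : 0 < G.minDegree)
    (hDd : (G.maxDegree : ℝ) ≤ (1 + θ ^ 2) * G.minDegree)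
    (hlam : secondEigenvalue G ≤ θ * G.maxDegree) (S : Finset V) :
    ∑ u, ((G.neighborFinset u ∩ S).card : ℝ) ^ 2 ≤
      (G.minDegree : ℝ) ^ 2 * (S.card * (S.card / Fintype.card V + 50 * θ)) := by
  have hlam0 := secondEigenvalue_nonneg G
  have hdD : (G.minDegree : ℝ) ≤ G.maxDegree := Nat.cast_le.2 G.minDegree_le_maxDegree
  have hd0 : (0 : ℝ) < G.minDegree := Nat.cast_pos.2 hd0
  have hmix := sum_card_inter_sq_le G (b := 2 * θ) (by positivity)
  set lam := secondEigenvalue G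
  set D : ℝ := (G.maxDegree : ℝ)
  set d : ℝ := (G.minDegree : ℝ)
  have hlam2 : lam ≤ 1 / 2 * D := hlam.trans (by gcongr; linarith)
  have hθ2 : θ ^ 2 ≤ θ / 100 := by nlinarith
  have hgap : D - d ≤ (2 * θ) ^ 2 * (D - lam) := by
    have h1 : θ ^ 2 * d ≤ θ ^ 2 * D := by gcongr
    have h3 : θ ^ 2 * lam ≤ θ ^ 2 * (1 / 2 * D) := by gcongr
    linarith
  refine (hmix (by linarith) hgap S).trans ?_
  set k : ℝ := (S.card : ℝ)
  set n : ℝ := (Fintype.card V : ℝ)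
  have hk0 : 0 ≤ k := Nat.cast_nonneg _
  have hn0 : 0 < n := Nat.cast_pos.2 Fintype.card_pos
  have hkn : k / n ≤ 1 := (div_le_one hn0).2 (Nat.cast_le.2 S.card_le_univ)
  have hkn0 : 0 ≤ k / n := by positivity
  have hD2 : D ^ 2 ≤ (1 + θ) * d ^ 2 := by
    have h1 : D ^ 2 ≤ ((1 + θ ^ 2) * d) ^ 2 := by gcongr
    refine h1.trans ?_
    rw [mul_pow]
    gcongr
    have h2 : θ ^ 2 * θ ^ 2 ≤ θ / 100 * 1 := by
      gcongr
      linarith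
    linarith
  have hlamD : lam ^ 2 ≤ θ * D ^ 2 := by
    have h1 : lam ^ 2 ≤ (θ * D) ^ 2 := by gcongr
    refine h1.trans ?_
    rw [mul_pow]
    gcongr
    linarith
  calc D ^ 2 * (k * (k / n + (2 * (2 * θ) + (2 * θ) ^ 2))) + lam ^ 2 * k
      ≤ D ^ 2 * (k * (k / n + (2 * (2 * θ) + (2 * θ) ^ 2))) + (θ * D ^ 2) * k := by gcongr
    _ = D ^ 2 * (k * (k / n + (5 * θ + 4 * θ ^ 2))) := by ring
    _ ≤ D ^ 2 * (k * (k / n + (5 * θ + 4 * (θ / 100)))) := by gcongr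
    _ ≤ ((1 + θ) * d ^ 2) * (k * (k / n + (5 * θ + 4 * (θ / 100)))) := by gcongr
    _ = d ^ 2 * (k * ((1 + θ) * (k / n + (5 * θ + 4 * (θ / 100))))) := by ring
    _ ≤ d ^ 2 * (k * (k / n + 50 * θ)) := by
      gcongr
      have h1 : θ * (k / n) ≤ θ * 1 := by gcongr
      linarith

theorem isQuasirandom_of_secondEigenvalue_le [Nonempty V] {θ : ℝ} (hθ0 : 0 < θ)
    (hθ : 100 * θ ≤ 1) (hn : 1 ≤ θ * Fintype.card V) (hd0 : 0 < G.minDegree)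
    (hDd : (G.maxDegree : ℝ) ≤ (1 + θ ^ 2) * G.minDegree)
    (hlam : secondEigenvalue G ≤ θ * G.maxDegree) : IsQuasirandom G (100 * θ) := by
  have hmix := sum_card_inter_sq_le_of_secondEigenvalue_le G hθ0 hθ hd0 hDd hlam
  have hd0' : (0 : ℝ) < G.minDegree := Nat.cast_pos.2 hd0
  refine ⟨hd0, hDd.trans ?_, ?_, fun S => (hmix S).trans ?_⟩
  · gcongr
    nlinarith
  -- Testing the mixing bound on `S = {u}` gives `d ≤ deg u ≤ 100 θ d²`, which forces the degrees to
  -- be large.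
  · obtain ⟨u⟩ := ‹Nonempty V›
    have h1 := hmix {u}
    rw [sum_card_inter_singleton_sq, Finset.card_singleton, Nat.cast_one, one_mul] at h1
    have h3 : (G.minDegree : ℝ) ≤ G.degree u := Nat.cast_le.2 (G.minDegree_le_degree u)
    have h4 : (1 : ℝ) / Fintype.card V ≤ θ :=
      div_le_of_le_mul₀ (Nat.cast_nonneg _) hθ0.le hn
    have h5 : (G.minDegree : ℝ) ^ 2 * (1 / Fintype.card V + 50 * θ) ≤
        (G.minDegree : ℝ) ^ 2 * (100 * θ) := by
      gcongr
      linarith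
    have h6 : (G.minDegree : ℝ) * 1 ≤ G.minDegree * (100 * θ * G.minDegree) := by
      linarith
    exact le_of_mul_le_mul_left h6 hd0'
  · gcongr
    linarith

variable {G} in
theorem IsQuasirandom.mono {η η' : ℝ} (h : IsQuasirandom G η) (hη : η ≤ η') :
    IsQuasirandom G η' where
  minDegree_pos := h.minDegree_pos
  maxDegree_le := h.maxDegree_le.trans (by gcongr)
  one_le := h.one_le.trans (by gcongr)
  mixing S := (h.mixing S).trans (by gcongr)

end Spectral

theorem IsExpanderSequence.eventually_isQuasirandom {G : ∀ n : ℕ, SimpleGraph (Fin n)}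
    [∀ n, DecidableRel (G n).Adj] (hG : IsExpanderSequence G) {η : ℝ} (hη : 0 < η) :
    ∀ᶠ n in atTop, IsQuasirandom (G n) η := by
  obtain ⟨θ, hθ0, hθη⟩ : ∃ θ : ℝ, 0 < θ ∧ 100 * θ ≤ min η 1 := by
    refine ⟨min η 1 / 100, by positivity, ?_⟩
    linarith
  have hθη1 := hθη.trans (min_le_left η 1)
  have hθη2 := hθη.trans (min_le_right η 1)
  have hratio := hG.degree_ratio.eventually (Metric.ball_mem_nhds (1 : ℝ) (pow_pos hθ0 2))
  have heig := hG.eigenvalue.def hθ0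
  have hlarge : ∀ᶠ n : ℕ in atTop, 1 / θ ≤ n := tendsto_natCast_atTop_atTop.eventually_ge_atTop _
  filter_upwards [hratio, heig, hlarge, eventually_ge_atTop 1] with n hr he hl hn1
  have : Nonempty (Fin n) := ⟨⟨0, hn1⟩⟩
  rw [Real.norm_of_nonneg (secondEigenvalue_nonneg (G n)),
    Real.norm_of_nonneg (Nat.cast_nonneg _)] at he
  have hr : |((G n).maxDegree : ℝ) / (G n).minDegree - 1| < θ ^ 2 := hr
  -- If the minimum degree were `0`, the ratio would be `0` by the convention for division, at
  -- distance `1` from its limit.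
  have hd0 : 0 < (G n).minDegree := by
    rw [Nat.pos_iff_ne_zero]
    intro h0
    rw [h0] at hr
    simp only [Nat.cast_zero, div_zero, zero_sub, abs_neg, abs_one] at hr
    nlinarith
  refine (isQuasirandom_of_secondEigenvalue_le (G n) hθ0 hθη2 ?_ hd0 ?_ he).mono hθη1
  · rw [Fintype.card_fin]
    rw [div_le_iff₀ hθ0] at hl
    linarith
  · have := (abs_lt.1 hr).2
    rw [sub_lt_iff_lt_add, div_lt_iff₀ (Nat.cast_pos.2 hd0)] at this
    linarith

/-! ### Growth and shrink rates, and elementary exponential inequalities. -/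

theorem pushRate_mem_Icc (P : Protocol) {q : ℝ} (hq : q ∈ Set.Icc (0 : ℝ) 1) :
    pushRate P q ∈ Set.Icc (0 : ℝ) 1 := by
  cases P <;> simp [pushRate, hq.1, hq.2]

theorem pullRate_mem_Icc (P : Protocol) {q : ℝ} (hq : q ∈ Set.Icc (0 : ℝ) 1) :
    pullRate P q ∈ Set.Icc (0 : ℝ) 1 := by
  cases P <;> simp [pullRate, hq.1, hq.2]

/-- The relative growth per round of a small informed set. -/
def growthRate (P : Protocol) (q : ℝ) : ℝ := pushRate P q + pullRate P q

/-- The factor by which a small uninformed set shrinks per round. -/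
noncomputable def shrinkRate (P : Protocol) (q : ℝ) : ℝ :=
  (1 - pullRate P q) * Real.exp (-pushRate P q)

theorem growthRate_pos (P : Protocol) {q : ℝ} (hq : 0 < q) : 0 < growthRate P q := by
  cases P <;> simp [growthRate, pushRate, pullRate, hq]

theorem growthRate_nonneg (P : Protocol) {q : ℝ} (hq : q ∈ Set.Icc (0 : ℝ) 1) :
    0 ≤ growthRate P q :=
  add_nonneg (pushRate_mem_Icc P hq).1 (pullRate_mem_Icc P hq).1

theorem growthRate_le (P : Protocol) {q : ℝ} (hq : q ∈ Set.Icc (0 : ℝ) 1) :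
    growthRate P q ≤ 2 := by
  have h1 := (pushRate_mem_Icc P hq).2
  have h2 := (pullRate_mem_Icc P hq).2
  unfold growthRate
  linarith

theorem one_sub_sum_le_prod_one_sub {ι : Type*} (s : Finset ι) (f : ι → ℝ)
    (h : ∀ i ∈ s, f i ∈ Set.Icc (0 : ℝ) 1) : 1 - ∑ i ∈ s, f i ≤ ∏ i ∈ s, (1 - f i) := by
  classical
  induction s using Finset.induction_on with
  | empty => simp
  | insert a s ha ih =>
    rw [Finset.sum_insert ha, Finset.prod_insert ha]
    have h1 := ih fun i hi => h i (Finset.mem_insert_of_mem hi)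
    have h2 := h a (Finset.mem_insert_self _ _)
    have h3 : 0 ≤ ∑ i ∈ s, f i :=
      Finset.sum_nonneg fun i hi => (h i (Finset.mem_insert_of_mem hi)).1
    nlinarith [mul_le_mul_of_nonneg_left h1 (sub_nonneg.2 h2.2), mul_nonneg h2.1 h3]

theorem exp_neg_le_quadratic {s : ℝ} (hs : 0 ≤ s) : Real.exp (-s) ≤ 1 - s + s ^ 2 / 2 := by
  rw [Real.exp_neg, inv_le_iff_one_le_mul₀ (Real.exp_pos s)]
  have h1 := Real.quadratic_le_exp_of_nonneg hs
  have h2 : 0 ≤ 1 - s + s ^ 2 / 2 := by nlinarith [sq_nonneg (s - 1)]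
  -- `(1 - s + s²/2) * (1 + s + s²/2) = 1 + s⁴/4`.
  nlinarith [mul_le_mul_of_nonneg_left h1 h2, sq_nonneg (s ^ 2)]

theorem div_three_le_one_sub_exp_neg {s : ℝ} (hs : 0 ≤ s) (hs2 : s ≤ 2) :
    s / 3 ≤ 1 - Real.exp (-s) := by
  have h1 : Real.exp (-s) ≤ 1 / (1 + s) := by
    rw [Real.exp_neg, ← one_div]
    gcongr
    linarith [Real.add_one_le_exp s]
  have h2 : 1 / (1 + s) ≤ 1 - s / 3 := by
    rw [div_le_iff₀ (by linarith)]
    nlinarith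
  linarith

theorem exp_neg_le_exp_neg_add {x y : ℝ} (hx : 0 ≤ x) (hxy : x ≤ y) :
    Real.exp (-x) ≤ Real.exp (-y) + (y - x) := by
  have h1 : 1 - (y - x) ≤ Real.exp (-(y - x)) := by linarith [Real.add_one_le_exp (-(y - x))]
  have h2 : Real.exp (-y) = Real.exp (-x) * Real.exp (-(y - x)) := by
    rw [← Real.exp_add]; ring_nf
  have h3 : Real.exp (-x) ≤ 1 := Real.exp_le_one_iff.2 (by linarith)
  have h4 := mul_le_mul_of_nonneg_left h1 (Real.exp_pos (-x)).le
  nlinarith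

theorem exp_neg_div_le_one_sub {x : ℝ} (hx1 : x < 1) :
    Real.exp (-(x / (1 - x))) ≤ 1 - x := by
  have h1 : 0 < 1 - x := by linarith
  rw [Real.exp_neg, inv_le_comm₀ (Real.exp_pos _) h1]
  have h2 := Real.add_one_le_exp (x / (1 - x))
  have h3 : x / (1 - x) + 1 = (1 - x)⁻¹ := by field_simp; ring
  rwa [h3] at h2

/-! ### Mean growth and shrinkage in a quasirandom graph. -/

section Estimates

set_option linter.unusedSectionVars false

variable {V : Type*} [Fintype V] [DecidableEq V] {G : SimpleGraph V} [DecidableRel G.Adj]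
  {η : ℝ} {P : Protocol} {q : ℝ} {I : Finset V}

theorem IsQuasirandom.degree_pos (h : IsQuasirandom G η) (w : V) : 0 < G.degree w :=
  h.minDegree_pos.trans_le (G.minDegree_le_degree w)

theorem IsQuasirandom.minDegree_cast_pos (h : IsQuasirandom G η) : (0 : ℝ) < G.minDegree := Nat.cast_pos.2 h.minDegree_pos

theorem IsQuasirandom.eta_pos (h : IsQuasirandom G η) : 0 < η := by
  have := h.one_le
  have := h.minDegree_cast_pos
  by_contra hη
  nlinarith [mul_nonpos_of_nonpos_of_nonneg (not_lt.1 hη) this.le]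

theorem IsQuasirandom.maxDegree_cast_pos (h : IsQuasirandom G η) : (0 : ℝ) < G.maxDegree :=
  h.minDegree_cast_pos.trans_le (Nat.cast_le.2 G.minDegree_le_maxDegree)

theorem minDegree_le_cast (w : V) : (G.minDegree : ℝ) ≤ G.degree w :=
  Nat.cast_le.2 (G.minDegree_le_degree w)

theorem degree_le_cast (w : V) : (G.degree w : ℝ) ≤ G.maxDegree :=
  Nat.cast_le.2 (G.degree_le_maxDegree w)

theorem card_inter_add_card_inter_compl (u : V) (S : Finset V) :
    ((G.neighborFinset u ∩ S).card : ℝ) + (G.neighborFinset u ∩ Sᶜ).card = G.degree u := by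
  rw [← Finset.sdiff_eq_inter_compl, ← G.card_neighborFinset_eq_degree]
  exact_mod_cast Finset.card_inter_add_card_sdiff _ _

theorem card_inter_le_degree (u : V) (S : Finset V) :
    ((G.neighborFinset u ∩ S).card : ℝ) ≤ G.degree u := by
  rw [← G.card_neighborFinset_eq_degree]
  exact_mod_cast Finset.card_le_card Finset.inter_subset_left

theorem sum_card_inter (S : Finset V) :
    ∑ u, ((G.neighborFinset u ∩ S).card : ℝ) = ∑ w ∈ S, (G.degree w : ℝ) := by
  have h := sum_sum_neighborFinset G fun w => if w ∈ S then (1 : ℝ) else 0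
  simp only [Finset.sum_boole, mul_ite, mul_one, mul_zero, Finset.filter_mem_eq_inter] at h
  rw [h, ← Finset.sum_filter]
  exact Finset.sum_congr (by ext; simp) fun _ _ => rfl

/-- Cauchy–Schwarz applied to the mixing bound: a sparse set spans few edges. -/
theorem IsQuasirandom.sum_card_inter_self_le (h : IsQuasirandom G η) {S : Finset V} {x : ℝ}
    (hx : S.card / Fintype.card V + η ≤ x) :
    ∑ u ∈ S, ((G.neighborFinset u ∩ S).card : ℝ) ≤ G.minDegree * S.card * √x := by
  have hx0 : 0 ≤ x := (add_nonneg (by positivity) h.eta_pos.le).trans hx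
  refine le_of_abs_le (abs_le_of_sq_le_sq ?_ (by positivity))
  have h1 : ∑ u ∈ S, ((G.neighborFinset u ∩ S).card : ℝ) ^ 2 ≤
      ∑ u, ((G.neighborFinset u ∩ S).card : ℝ) ^ 2 :=
    Finset.sum_le_sum_of_subset_of_nonneg (Finset.subset_univ _) fun _ _ _ => sq_nonneg _
  refine sq_sum_le_card_mul_sum_sq.trans ?_
  rw [mul_pow, Real.sq_sqrt hx0]
  calc (S.card : ℝ) * ∑ u ∈ S, ((G.neighborFinset u ∩ S).card : ℝ) ^ 2
      ≤ S.card * ((G.minDegree : ℝ) ^ 2 * (S.card * (S.card / Fintype.card V + η))) := by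
        gcongr
        exact h1.trans (h.mixing S)
    _ = (G.minDegree * S.card) ^ 2 * (S.card / Fintype.card V + η) := by ring
    _ ≤ _ := by gcongr

/-- The number of calls between a set and its complement. -/
theorem IsQuasirandom.le_sum_card_inter_compl (h : IsQuasirandom G η) {S : Finset V} {x : ℝ}
    (hx : S.card / Fintype.card V + η ≤ x) :
    G.minDegree * S.card * (1 - √x) ≤ ∑ u ∈ S, ((G.neighborFinset u ∩ Sᶜ).card : ℝ) := by
  have h1 := h.sum_card_inter_self_le hx
  have h2 : ∑ u ∈ S, ((G.neighborFinset u ∩ S).card : ℝ) +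
      ∑ u ∈ S, ((G.neighborFinset u ∩ Sᶜ).card : ℝ) = ∑ u ∈ S, (G.degree u : ℝ) := by
    rw [← Finset.sum_add_distrib]
    exact Finset.sum_congr rfl fun u _ => card_inter_add_card_inter_compl u S
  have h3 : (G.minDegree : ℝ) * S.card ≤ ∑ u ∈ S, (G.degree u : ℝ) := by
    rw [mul_comm, ← nsmul_eq_mul]
    exact Finset.card_nsmul_le_sum _ _ _ fun u _ => minDegree_le_cast u
  nlinarith

theorem sum_compl_card_inter (S : Finset V) :
    ∑ u ∈ Sᶜ, ((G.neighborFinset u ∩ S).card : ℝ) =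
      ∑ u ∈ S, ((G.neighborFinset u ∩ Sᶜ).card : ℝ) := by
  have h1 := sum_card_inter (G := G) S
  rw [← Finset.sum_add_sum_compl S] at h1
  have h2 : ∑ u ∈ S, ((G.neighborFinset u ∩ S).card : ℝ) +
      ∑ u ∈ S, ((G.neighborFinset u ∩ Sᶜ).card : ℝ) = ∑ u ∈ S, (G.degree u : ℝ) := by
    rw [← Finset.sum_add_distrib]
    exact Finset.sum_congr rfl fun u _ => card_inter_add_card_inter_compl u S
  linarith

theorem IsQuasirandom.prod_one_sub_le_exp (h : IsQuasirandom G η) {a : ℝ}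
    (ha : a ∈ Set.Icc (0 : ℝ) 1) (u : V) :
    ∏ w ∈ G.neighborFinset u ∩ I, (1 - a / G.degree w) ≤
      Real.exp (-(a * (G.neighborFinset u ∩ I).card / G.maxDegree)) := by
  calc ∏ w ∈ G.neighborFinset u ∩ I, (1 - a / G.degree w)
      ≤ ∏ w ∈ G.neighborFinset u ∩ I, Real.exp (-(a / G.maxDegree)) := by
        refine Finset.prod_le_prod (fun w _ => ?_) fun w _ => ?_
        · have : (1 : ℝ) ≤ G.degree w := by exact_mod_cast h.degree_pos w
          rw [sub_nonneg, div_le_one (by linarith)]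
          exact ha.2.trans this
        · refine le_trans ?_ (Real.one_sub_le_exp_neg _)
          have := ha.1
          have : (0 : ℝ) < G.degree w := by exact_mod_cast h.degree_pos w
          gcongr
          exact G.degree_le_maxDegree w
    _ = _ := by
      rw [Finset.prod_const, ← Real.exp_nat_mul]
      ring_nf

/-- By `1 - x ≤ exp (-x)`, push and pull contribute exponents of the same shape, so only the sum of
their rates matters. -/
theorem IsQuasirandom.stayProb_le_exp (h : IsQuasirandom G η) (hq : q ∈ Set.Icc (0 : ℝ) 1)
    (u : V) :
    stayProb G P q I u ≤
      Real.exp (-(growthRate P q * (G.neighborFinset u ∩ I).card / G.maxDegree)) := by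
  have h1 := h.prod_one_sub_le_exp (I := I) (pushRate_mem_Icc P hq) u
  have h2 : 1 - pullRate P q * (G.neighborFinset u ∩ I).card / G.degree u ≤
      Real.exp (-(pullRate P q * (G.neighborFinset u ∩ I).card / G.maxDegree)) := by
    refine le_trans ?_ (Real.one_sub_le_exp_neg _)
    have := (pullRate_mem_Icc P hq).1
    have : (0 : ℝ) < G.degree u := by exact_mod_cast h.degree_pos u
    gcongr
    exact G.degree_le_maxDegree u
  have h3 : 0 ≤ ∏ w ∈ G.neighborFinset u ∩ I, (1 - pushRate P q / G.degree w) := by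
    refine Finset.prod_nonneg fun w _ => ?_
    have : (1 : ℝ) ≤ G.degree w := by exact_mod_cast h.degree_pos w
    rw [sub_nonneg, div_le_one (by linarith)]
    exact (pushRate_mem_Icc P hq).2.trans this
  refine (mul_le_mul h2 h1 h3 (Real.exp_pos _).le).trans_eq ?_
  rw [← Real.exp_add, growthRate]
  ring_nf

/-- A union bound over the calls that could inform `u`. -/
theorem IsQuasirandom.one_sub_stayProb_le (h : IsQuasirandom G η) (hq : q ∈ Set.Icc (0 : ℝ) 1)
    (u : V) :
    1 - stayProb G P q I u ≤ growthRate P q * (G.neighborFinset u ∩ I).card / G.minDegree := by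
  have ha := pushRate_mem_Icc P hq
  have hb := pullRate_mem_Icc P hq
  have hd := h.minDegree_cast_pos
  have hdw : ∀ w, (0 : ℝ) < G.degree w := fun w => by exact_mod_cast h.degree_pos w
  have hdw1 : ∀ w, (1 : ℝ) ≤ G.degree w := fun w => by exact_mod_cast h.degree_pos w
  have h1 := one_sub_sum_le_prod_one_sub (G.neighborFinset u ∩ I)
    (fun w => pushRate P q / G.degree w) fun w _ =>
      ⟨div_nonneg ha.1 (hdw w).le, (div_le_one (hdw w)).2 (ha.2.trans (hdw1 w))⟩
  have h2 : ∑ w ∈ G.neighborFinset u ∩ I, pushRate P q / G.degree w ≤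
      pushRate P q * (G.neighborFinset u ∩ I).card / G.minDegree := by
    calc ∑ w ∈ G.neighborFinset u ∩ I, pushRate P q / G.degree w
        ≤ ∑ w ∈ G.neighborFinset u ∩ I, pushRate P q / G.minDegree := by
          refine Finset.sum_le_sum fun w _ => ?_
          have := ha.1
          gcongr
          exact G.minDegree_le_degree w
      _ = _ := by rw [Finset.sum_const, nsmul_eq_mul]; ring
  set x : ℝ := pullRate P q * (G.neighborFinset u ∩ I).card / G.degree u
  have hx0 : 0 ≤ x := div_nonneg (mul_nonneg hb.1 (Nat.cast_nonneg _)) (hdw u).le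
  have hx1 : x ≤ 1 := by
    rw [div_le_one (hdw u)]
    have := card_inter_le_degree (G := G) u I
    nlinarith [hb.1, hb.2, hdw u]
  have hx : x ≤ pullRate P q * (G.neighborFinset u ∩ I).card / G.minDegree := by
    have := hb.1
    simp only [x]
    gcongr
    exact G.minDegree_le_degree u
  have h0 : 0 ≤ ∑ w ∈ G.neighborFinset u ∩ I, pushRate P q / G.degree w :=
    Finset.sum_nonneg fun w _ => div_nonneg ha.1 (hdw w).le
  have h3 : 1 - stayProb G P q I u ≤
      x + ∑ w ∈ G.neighborFinset u ∩ I, pushRate P q / G.degree w := by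
    have : stayProb G P q I u =
      (1 - x) * ∏ w ∈ G.neighborFinset u ∩ I, (1 - pushRate P q / G.degree w) := rfl
    rw [this]
    nlinarith [mul_le_mul_of_nonneg_left h1 (sub_nonneg.2 hx1), mul_nonneg hx0 h0]
  refine h3.trans ((add_le_add hx h2).trans_eq ?_)
  rw [growthRate]
  ring

variable {q : unitInterval}

theorem card_compl_sub_meanStay :
    (Iᶜ.card : ℝ) - meanStay G P q I = ∑ u ∈ Iᶜ, (1 - stayProb G P q I u) := by
  rw [meanStay, Finset.sum_sub_distrib]
  simp

/-- The expected number of newly informed vertices is at most `c (1 + η) |I|`. -/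
theorem IsQuasirandom.card_compl_sub_meanStay_le (h : IsQuasirandom G η) :
    (Iᶜ.card : ℝ) - meanStay G P q I ≤ growthRate P q * (1 + η) * I.card := by
  have hc := growthRate_nonneg P q.2
  have hd := h.minDegree_cast_pos
  rw [card_compl_sub_meanStay]
  calc ∑ u ∈ Iᶜ, (1 - stayProb G P q I u)
      ≤ ∑ u ∈ Iᶜ, growthRate P q * (G.neighborFinset u ∩ I).card / G.minDegree :=
        Finset.sum_le_sum fun u _ => h.one_sub_stayProb_le q.2 u
    _ ≤ ∑ u, growthRate P q * (G.neighborFinset u ∩ I).card / G.minDegree :=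
        Finset.sum_le_sum_of_subset_of_nonneg (Finset.subset_univ _) fun _ _ _ => by positivity
    _ = growthRate P q / G.minDegree * ∑ w ∈ I, (G.degree w : ℝ) := by
        rw [← sum_card_inter, Finset.mul_sum]
        exact Finset.sum_congr rfl fun _ _ => by ring
    _ ≤ growthRate P q / G.minDegree * (I.card * ((1 + η) * G.minDegree)) := by
        gcongr
        rw [← nsmul_eq_mul]
        exact Finset.sum_le_card_nsmul _ _ _ fun w _ => (degree_le_cast w).trans h.maxDegree_le
    _ = _ := by field_simp

/-- The expected number of newly informed vertices is almost `c |I|` if `|I|` is small. -/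
theorem IsQuasirandom.le_card_compl_sub_meanStay (h : IsQuasirandom G η) (hη : η ≤ 1 / 2)
    (hI : (I.card : ℝ) ≤ η * Fintype.card V) :
    growthRate P q * I.card * (1 - √(2 * η) - 3 * η) ≤ (Iᶜ.card : ℝ) - meanStay G P q I := by
  have hη0 := h.eta_pos
  have hc := growthRate_nonneg P q.2
  have hc2 := growthRate_le P q.2
  have hd := h.minDegree_cast_pos
  have hD := h.maxDegree_cast_pos
  have hdD : (G.minDegree : ℝ) ≤ G.maxDegree := Nat.cast_le.2 G.minDegree_le_maxDegree
  set c := growthRate P q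
  set D : ℝ := (G.maxDegree : ℝ)
  set d : ℝ := (G.minDegree : ℝ)
  set k : ℝ := (I.card : ℝ)
  have hk : 0 ≤ k := Nat.cast_nonneg _
  have hkn : k / Fintype.card V + η ≤ 2 * η := by
    have : k / Fintype.card V ≤ η := div_le_of_le_mul₀ (Nat.cast_nonneg _) hη0.le hI
    linarith
  have hs : √(2 * η) ≤ 1 := Real.sqrt_le_one.2 (by linarith)
  rw [card_compl_sub_meanStay]
  -- `1 - exp (-s) ≥ s - s² / 2`. Summed over `u`, the linear term counts the edges leaving `I`, and
  -- the quadratic loss is controlled by mixing.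
  have h1 : ∀ u, c / D * (G.neighborFinset u ∩ I).card -
      c ^ 2 / D ^ 2 / 2 * ((G.neighborFinset u ∩ I).card : ℝ) ^ 2 ≤ 1 - stayProb G P q I u := by
    intro u
    have h2 := h.stayProb_le_exp (P := P) (I := I) q.2 u
    have h3 := exp_neg_le_quadratic (s := c * (G.neighborFinset u ∩ I).card / D) (by positivity)
    have h4 : (c * (G.neighborFinset u ∩ I).card / D) ^ 2 / 2 =
      c ^ 2 / D ^ 2 / 2 * ((G.neighborFinset u ∩ I).card : ℝ) ^ 2 := by ring
    have h5 : c * (G.neighborFinset u ∩ I).card / D = c / D * (G.neighborFinset u ∩ I).card := by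
      ring
    rw [h4, h5] at h3
    rw [h5] at h2
    linarith
  refine le_trans ?_ (Finset.sum_le_sum fun u _ => h1 u)
  rw [Finset.sum_sub_distrib, ← Finset.mul_sum, ← Finset.mul_sum, sum_compl_card_inter]
  have h2 := h.le_sum_card_inter_compl hkn
  have h3 : ∑ u ∈ Iᶜ, ((G.neighborFinset u ∩ I).card : ℝ) ^ 2 ≤ d ^ 2 * (k * (2 * η)) :=
    (Finset.sum_le_sum_of_subset_of_nonneg (Finset.subset_univ _) fun _ _ _ => sq_nonneg _).trans
      ((h.mixing I).trans (by gcongr))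
  have h4 : c / D * (d * k * (1 - √(2 * η))) ≤
      c / D * ∑ u ∈ I, ((G.neighborFinset u ∩ Iᶜ).card : ℝ) := by gcongr
  have h5 : c ^ 2 / D ^ 2 / 2 * ∑ u ∈ Iᶜ, ((G.neighborFinset u ∩ I).card : ℝ) ^ 2 ≤
      c ^ 2 / D ^ 2 / 2 * (d ^ 2 * (k * (2 * η))) := by gcongr
  have h6 : c ^ 2 / D ^ 2 / 2 * (d ^ 2 * (k * (2 * η))) ≤ 2 * c * k * η := by
    have h7 : d ^ 2 / D ^ 2 ≤ 1 := (div_le_one (by positivity)).2 (by gcongr)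
    have h8 : c ^ 2 ≤ 2 * c := by nlinarith
    calc c ^ 2 / D ^ 2 / 2 * (d ^ 2 * (k * (2 * η))) = c ^ 2 * (k * η) * (d ^ 2 / D ^ 2) := by
          field_simp
      _ ≤ (2 * c) * (k * η) * 1 := by gcongr
      _ = _ := by ring
  have h9 : c * k * (1 - η) * (1 - √(2 * η)) ≤ c / D * (d * k * (1 - √(2 * η))) := by
    have h7 : 1 - η ≤ d / D := by
      rw [le_div_iff₀ hD]
      have := h.maxDegree_le
      nlinarith
    have : c / D * (d * k * (1 - √(2 * η))) = c * k * (d / D) * (1 - √(2 * η)) := by ring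
    rw [this]
    have : 0 ≤ 1 - √(2 * η) := by linarith
    gcongr
  have h10 : c * k * (1 - √(2 * η) - η) ≤ c * k * (1 - η) * (1 - √(2 * η)) := by
    have : 0 ≤ η * √(2 * η) := by positivity
    rw [mul_assoc (c * k)]
    exact mul_le_mul_of_nonneg_left (by linarith) (mul_nonneg hc hk)
  linarith

/-- If the informed set has positive density, then the uninformed set shrinks geometrically in
expectation. -/
theorem IsQuasirandom.meanStay_le_of_dense (h : IsQuasirandom G η) {ε : ℝ} (hη1 : η ≤ 1)
    (hηε : η ≤ ε / 2) (hI : (Iᶜ.card : ℝ) ≤ (1 - ε) * Fintype.card V) :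
    meanStay G P q I ≤ (1 - growthRate P q / 6 * (1 - √(1 - ε / 2))) * Iᶜ.card := by
  have hη0 := h.eta_pos
  have hc := growthRate_nonneg P q.2
  have hc2 := growthRate_le P q.2
  have hd := h.minDegree_cast_pos
  have hD := h.maxDegree_cast_pos
  set c := growthRate P q
  set D : ℝ := (G.maxDegree : ℝ)
  set d : ℝ := (G.minDegree : ℝ)
  set l : ℝ := (Iᶜ.card : ℝ)
  have hl : 0 ≤ l := Nat.cast_nonneg _
  have hs : √(1 - ε / 2) ≤ 1 := Real.sqrt_le_one.2 (by linarith)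
  rcases isEmpty_or_nonempty V with hV | hV
  · have : Iᶜ = ∅ := Finset.eq_empty_of_isEmpty _
    simp [meanStay, l, this]
  have hn : (0 : ℝ) < Fintype.card V := Nat.cast_pos.2 Fintype.card_pos
  have hkn : l / Fintype.card V + η ≤ 1 - ε / 2 := by
    have : l / Fintype.card V ≤ 1 - ε := by rwa [div_le_iff₀ hn]
    linarith
  have hmain : c / 6 * (1 - √(1 - ε / 2)) * l ≤ l - meanStay G P q I := by
    rw [card_compl_sub_meanStay]
    -- Here the exponent is not small, only at most `c ≤ 2`, so a linear bound with constant `1 / 3`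
    -- is used. The crossing edges are then counted from the uninformed side; `D ≤ 2 d` turns `1 /
    -- 3` into `1 / 6`.
    have h1 : ∀ u, c / D / 3 * (G.neighborFinset u ∩ I).card ≤ 1 - stayProb G P q I u := by
      intro u
      have h2 := h.stayProb_le_exp (P := P) (I := I) q.2 u
      have h3 := div_three_le_one_sub_exp_neg (s := c * (G.neighborFinset u ∩ I).card / D)
        (by positivity) (by
          rw [div_le_iff₀ hD]
          have := (card_inter_le_degree (G := G) u I).trans (degree_le_cast u)
          gcongr)
      have h4 : c * (G.neighborFinset u ∩ I).card / D / 3 =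
        c / D / 3 * (G.neighborFinset u ∩ I).card := by ring
      rw [h4] at h3
      linarith
    refine le_trans ?_ (Finset.sum_le_sum fun u _ => h1 u)
    rw [← Finset.mul_sum]
    have h2 := h.le_sum_card_inter_compl hkn
    rw [compl_compl] at h2
    have h7 : 1 / 2 ≤ d / D := by
      rw [le_div_iff₀ hD]
      have := h.maxDegree_le
      nlinarith
    calc c / 6 * (1 - √(1 - ε / 2)) * l = c / 3 * (1 / 2) * l * (1 - √(1 - ε / 2)) := by ring
      _ ≤ c / 3 * (d / D) * l * (1 - √(1 - ε / 2)) := by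
        have : 0 ≤ 1 - √(1 - ε / 2) := by linarith
        gcongr
      _ = c / D / 3 * (d * l * (1 - √(1 - ε / 2))) := by ring
      _ ≤ _ := by gcongr
  linarith

/-- A small uninformed set shrinks by the factor `shrinkRate` in expectation, up to an error. -/
theorem IsQuasirandom.meanStay_le_of_card_compl_le (h : IsQuasirandom G η)
    (hI : (Iᶜ.card : ℝ) ≤ η * Fintype.card V) :
    meanStay G P q I ≤ (shrinkRate P q + η + 2 * √(2 * η)) * Iᶜ.card := by
  have hη0 := h.eta_pos
  have ha := pushRate_mem_Icc P q.2
  have hb := pullRate_mem_Icc P q.2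
  have hd := h.minDegree_cast_pos
  have hD := h.maxDegree_cast_pos
  have hdD : (G.minDegree : ℝ) ≤ G.maxDegree := Nat.cast_le.2 G.minDegree_le_maxDegree
  have hDd := h.maxDegree_le
  have hkn : (Iᶜ.card : ℝ) / Fintype.card V + η ≤ 2 * η := by
    have : (Iᶜ.card : ℝ) / Fintype.card V ≤ η :=
      div_le_of_le_mul₀ (Nat.cast_nonneg _) hη0.le hI
    linarith
  -- If all neighbours of `u` are informed, only the `η` error remains; each uninformed neighbour
  -- costs at most `1 / d` in the pull factor and `1 / d` in the push factor. The total cost is the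
  -- number of edges inside `Iᶜ`, which is small.
  have hu : ∀ u, stayProb G P q I u ≤
      shrinkRate P q + η + 2 / G.minDegree * (G.neighborFinset u ∩ Iᶜ).card := by
    intro u
    have hdu := minDegree_le_cast (G := G) u
    have hdu' := degree_le_cast (G := G) u
    have hsum := card_inter_add_card_inter_compl (G := G) u I
    have hle := card_inter_le_degree (G := G) u I
    have hprod := h.prod_one_sub_le_exp (I := I) ha u
    have hprod1 : Real.exp (-(pushRate P q * (G.neighborFinset u ∩ I).card / G.maxDegree)) ≤ 1 := by
      rw [Real.exp_le_one_iff, neg_nonpos]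
      have := ha.1
      positivity
    simp only [stayProb, shrinkRate]
    set a := pushRate P q
    set b := pullRate P q
    set e : ℝ := ((G.neighborFinset u ∩ I).card : ℝ)
    set f : ℝ := ((G.neighborFinset u ∩ Iᶜ).card : ℝ)
    set d : ℝ := (G.minDegree : ℝ)
    set D : ℝ := (G.maxDegree : ℝ)
    have he0 : 0 ≤ e := Nat.cast_nonneg _
    have hf0 : 0 ≤ f := Nat.cast_nonneg _
    have hdu0 : (0 : ℝ) < G.degree u := hd.trans_le hdu
    have hA : 1 - b * e / G.degree u ≤ (1 - b) + f / d := by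
      have h1 : b * e / G.degree u = b - b * (f / G.degree u) := by
        rw [eq_sub_iff_add_eq, ← mul_div_assoc, ← add_div, ← mul_add, hsum]
        field_simp
      have h2 : f / G.degree u ≤ f / d := by gcongr
      have h3 : b * (f / G.degree u) ≤ 1 * (f / G.degree u) := by
        gcongr
        exact hb.2
      linarith
    have hA0 : 0 ≤ 1 - b * e / G.degree u := by
      rw [sub_nonneg, div_le_one hdu0]
      nlinarith [hb.1, hb.2]
    have hA1 : 1 - b * e / G.degree u ≤ 1 := by
      have := hb.1
      have : 0 ≤ b * e / G.degree u := by positivity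
      linarith
    have hB : Real.exp (-(a * e / D)) ≤ Real.exp (-a) + (η + f / d) := by
      have he1 : e / D ≤ 1 := (div_le_one hD).2 (hle.trans hdu')
      have h1 := exp_neg_le_exp_neg_add (x := a * e / D) (y := a)
        (by have := ha.1; positivity)
        (by rw [mul_div_assoc]; exact mul_le_of_le_one_right ha.1 he1)
      have h2 : a - a * e / D ≤ 1 - e / D := by
        rw [mul_div_assoc]
        nlinarith [ha.1, ha.2]
      have h3 : 1 - e / D ≤ η + f / d := by
        have h4 : f / D ≤ f / d := by gcongr
        have h5 : d / D ≤ (e + f) / D := by rw [hsum]; gcongr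
        have h6 : 1 - η ≤ d / D := by
          rw [le_div_iff₀ hD]
          nlinarith
        rw [add_div] at h5
        linarith
      linarith
    have hea : Real.exp (-a) ≤ 1 := Real.exp_le_one_iff.2 (by linarith [ha.1])
    have hea0 := Real.exp_pos (-a)
    have hfd : 0 ≤ f / d := by positivity
    have h2f : 2 / d * f = 2 * (f / d) := by ring
    rw [h2f]
    calc (1 - b * e / G.degree u) * ∏ w ∈ G.neighborFinset u ∩ I, (1 - a / G.degree w)
        ≤ (1 - b * e / G.degree u) * (Real.exp (-a) + (η + f / d)) :=
          mul_le_mul_of_nonneg_left (hprod.trans hB) hA0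
      _ = (1 - b * e / G.degree u) * Real.exp (-a) +
          (1 - b * e / G.degree u) * (η + f / d) := by ring
      _ ≤ ((1 - b) + f / d) * Real.exp (-a) + 1 * (η + f / d) := by gcongr
      _ ≤ _ := by nlinarith
  calc meanStay G P q I
      ≤ ∑ u ∈ Iᶜ, (shrinkRate P q + η + 2 / G.minDegree * (G.neighborFinset u ∩ Iᶜ).card) :=
        Finset.sum_le_sum fun u _ => hu u
    _ = (shrinkRate P q + η) * Iᶜ.card + 2 / G.minDegree *
          ∑ u ∈ Iᶜ, ((G.neighborFinset u ∩ Iᶜ).card : ℝ) := by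
        rw [Finset.sum_add_distrib, Finset.sum_const, nsmul_eq_mul, ← Finset.mul_sum]
        ring
    _ ≤ (shrinkRate P q + η) * Iᶜ.card + 2 / G.minDegree *
          (G.minDegree * Iᶜ.card * √(2 * η)) := by
        gcongr
        exact h.sum_card_inter_self_le hkn
    _ = _ := by field_simp

/-- A vertex stays uninformed with probability at least almost `shrinkRate`. -/
theorem IsQuasirandom.le_stayProb (h : IsQuasirandom G η) (hη : η < 1) (u : V) :
    (1 - pullRate P q) * Real.exp (-(pushRate P q * ((1 + η) / (1 - η)))) ≤
      stayProb G P q I u := by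
  have hη0 := h.eta_pos
  have ha := pushRate_mem_Icc P q.2
  have hb := pullRate_mem_Icc P q.2
  have hd := h.minDegree_cast_pos
  have hdw : ∀ w, (0 : ℝ) < G.degree w := fun w => by exact_mod_cast h.degree_pos w
  have h1η : 0 < 1 - η := by linarith
  unfold stayProb
  have hA : 1 - pullRate P q ≤ 1 - pullRate P q * (G.neighborFinset u ∩ I).card / G.degree u := by
    rw [mul_div_assoc]
    have : ((G.neighborFinset u ∩ I).card : ℝ) / G.degree u ≤ 1 :=
      (div_le_one (hdw u)).2 (card_inter_le_degree u I)
    nlinarith [hb.1]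
  refine mul_le_mul hA ?_ (Real.exp_pos _).le (by linarith [hb.2])
  calc Real.exp (-(pushRate P q * ((1 + η) / (1 - η))))
      ≤ Real.exp ((G.neighborFinset u ∩ I).card *
          -(pushRate P q / G.minDegree / (1 - η))) := by
        rw [Real.exp_le_exp, mul_neg, neg_le_neg_iff]
        have h1 : ((G.neighborFinset u ∩ I).card : ℝ) ≤ (1 + η) * G.minDegree :=
          (card_inter_le_degree u I).trans ((degree_le_cast u).trans h.maxDegree_le)
        have := ha.1
        calc ((G.neighborFinset u ∩ I).card : ℝ) * (pushRate P q / G.minDegree / (1 - η))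
            ≤ ((1 + η) * G.minDegree) * (pushRate P q / G.minDegree / (1 - η)) := by gcongr
          _ = _ := by field_simp
    _ = ∏ w ∈ G.neighborFinset u ∩ I, Real.exp (-(pushRate P q / G.minDegree / (1 - η))) := by
        rw [Finset.prod_const, ← Real.exp_nat_mul]
    _ ≤ _ := by
        refine Finset.prod_le_prod (fun w _ => (Real.exp_pos _).le) fun w _ => ?_
        have h2 : pushRate P q / G.degree w ≤ pushRate P q / G.minDegree := by
          have := ha.1
          gcongr
          exact G.minDegree_le_degree w
        have h3 : pushRate P q / G.minDegree ≤ η := by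
          rw [div_le_iff₀ hd]
          exact ha.2.trans h.one_le
        have h4 := exp_neg_div_le_one_sub (x := pushRate P q / G.degree w) (by linarith)
        refine le_trans (Real.exp_le_exp.2 (neg_le_neg ?_)) h4
        have h5 : 0 ≤ pushRate P q / G.degree w := div_nonneg ha.1 (hdw w).le
        have h6 : 0 ≤ pushRate P q / G.minDegree := h5.trans h2
        gcongr
        linarith

end Estimates

/-! ### The process as iterates of the one-round operator. -/

section Chain

set_option linter.unusedSectionVars false

variable {V : Type*} [Fintype V] [DecidableEq V]

theorem informed_congr (P : Protocol) (v : V) {ω ω' : ℕ → Round V} {t : ℕ}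
    (h : ∀ i < t, ω i = ω' i) : informed P v ω t = informed P v ω' t := by
  induction t with
  | zero => rfl
  | succ t ih =>
    simp only [informed]
    rw [ih fun i hi => h i (hi.trans t.lt_succ_self), h t t.lt_succ_self]

theorem informed_mono (P : Protocol) (v : V) (ω : ℕ → Round V) : Monotone (informed P v ω) :=
  monotone_nat_of_le_succ fun _ => subset_nextInformed P _ _

/-- The informed set after `t` rounds as a function of the first `t` rounds. -/
def informedOfRange (P : Protocol) (v : V) (t : ℕ) (x : Finset.range t → Round V) : Finset V :=
  informed P v (fun i => if h : i ∈ Finset.range t then x ⟨i, h⟩ else fun u => (u, true)) t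

/-- Rounds from `t` on are never read, so the dummy values there do not matter. Passing to finitely
many rounds gives a finite space, where measurability and integrability are automatic. -/
theorem informedOfRange_restrict (P : Protocol) (v : V) (t : ℕ) (ω : ℕ → Round V) :
    informedOfRange P v t (fun i => ω i) = informed P v ω t :=
  informed_congr P v fun i hi => by simp [hi]

variable [MeasurableSpace V] [MeasurableSingletonClass V] {G : SimpleGraph V} [DecidableRel G.Adj]
  {P : Protocol} {q : unitInterval} {F F' : Finset V → ℝ} {I : Finset V}

theorem measurableSet_informed (v : V) (t : ℕ) (p : Finset V → Prop) :
    MeasurableSet {ω : ℕ → Round V | p (informed P v ω t)} := by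
  have : {ω : ℕ → Round V | p (informed P v ω t)} =
      (fun (ω : ℕ → Round V) (i : Finset.range t) => ω i) ⁻¹' {x | p (informedOfRange P v t x)} := by
    ext ω
    simp only [Set.preimage_ofPred_eq, informedOfRange_restrict]
  rw [this]
  exact (by fun_prop : Measurable fun (ω : ℕ → Round V) (i : Finset.range t) => ω i)
    (Set.toFinite _).measurableSet

/-- The Markov property: round `t` is independent of the earlier rounds, which determine the current
informed set, so Fubini applies to the product law. -/
theorem integral_informed_succ (v : V) (t : ℕ) (F : Finset V → ℝ) :
    ∫ ω, F (informed P v ω (t + 1)) ∂processLaw G q =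
      ∫ ω, stepMean G P q F (informed P v ω t) ∂processLaw G q := by
  set X : (ℕ → Round V) → (Finset.range t → Round V) := fun ω i => ω i
  set Y : (ℕ → Round V) → Round V := fun ω => ω t
  have hX : Measurable X := by fun_prop
  have hY : Measurable Y := by fun_prop
  have hind : IndepFun X Y (processLaw G q) := by
    have h := (iIndepFun_infinitePi (P := fun _ : ℕ => roundLaw G q) (X := fun _ r => r)
      fun _ => measurable_id).indepFun_finset (Finset.range t) {t} (by simp)
      fun i => by fun_prop
    exact h.comp (φ := id) (ψ := fun x : ({t} : Finset ℕ) → Round V => x ⟨t, by simp⟩)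
      measurable_id (measurable_pi_apply _)
  have hmap : (processLaw G q).map (fun ω => (X ω, Y ω)) =
      ((processLaw G q).map X).prod (roundLaw G q) := by
    rw [hind.map_prod_eq_prod_map_map hX.aemeasurable hY.aemeasurable]
    congr 1
    exact Measure.infinitePi_map_eval (fun _ : ℕ => roundLaw G q) t
  have : IsProbabilityMeasure ((processLaw G q).map X) :=
    Measure.isProbabilityMeasure_map hX.aemeasurable
  have h1 : ∀ ω, F (informed P v ω (t + 1)) =
      (fun z : (Finset.range t → Round V) × Round V =>
        F (nextInformed P (informedOfRange P v t z.1) z.2)) (X ω, Y ω) := fun ω => by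
    simp only [X, Y, informedOfRange_restrict, informed]
  have h2 : ∀ ω, stepMean G P q F (informed P v ω t) =
      (fun x => stepMean G P q F (informedOfRange P v t x)) (X ω) := fun ω => by
    simp only [X, informedOfRange_restrict]
  rw [integral_congr_ae (ae_of_all _ h1), integral_congr_ae (ae_of_all _ h2),
    ← integral_map (μ := processLaw G q) (φ := fun ω => (X ω, Y ω)) (hX.prodMk hY).aemeasurable
      (f := fun z : (Finset.range t → Round V) × Round V =>
        F (nextInformed P (informedOfRange P v t z.1) z.2))
      (measurable_of_finite _).aestronglyMeasurable, hmap,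
    integral_prod _ Integrable.of_finite,
    ← integral_map (μ := processLaw G q) (f := fun x => stepMean G P q F (informedOfRange P v t x))
      hX.aemeasurable (measurable_of_finite _).aestronglyMeasurable]
  rfl

theorem integral_informed (v : V) (t : ℕ) (F : Finset V → ℝ) :
    ∫ ω, F (informed P v ω t) ∂processLaw G q = (stepMean G P q)^[t] F {v} := by
  induction t generalizing F with
  | zero => simp [informed]
  | succ t ih => rw [integral_informed_succ, ih, Function.iterate_succ_apply]

theorem processLaw_real_informed (v : V) (t : ℕ) (p : Finset V → Prop) [DecidablePred p] :
    (processLaw G q).real {ω | p (informed P v ω t)} =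
      (stepMean G P q)^[t] (fun J => if p J then 1 else 0) {v} := by
  rw [← integral_informed, ← integral_indicator_one (measurableSet_informed v t p)]
  refine integral_congr_ae (ae_of_all _ fun r => ?_)
  simp [Set.indicator_apply]

theorem iterate_stepMean_mono (t : ℕ) (h : ∀ J, I ⊆ J → F J ≤ F' J) :
    (stepMean G P q)^[t] F I ≤ (stepMean G P q)^[t] F' I := by
  induction t generalizing I with
  | zero => exact h I subset_rfl
  | succ t ih =>
    rw [Function.iterate_succ_apply', Function.iterate_succ_apply']
    exact stepMean_mono fun J hJ => ih fun J' hJ' => h J' (hJ.trans hJ')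

theorem iterate_stepMean_const (t : ℕ) (c : ℝ) : (stepMean G P q)^[t] (fun _ => c) I = c := by
  induction t generalizing I with
  | zero => rfl
  | succ t ih =>
    rw [Function.iterate_succ_apply', stepMean_congr fun J _ => ih, stepMean_const]

theorem iterate_stepMean_const_mul (t : ℕ) (c : ℝ) :
    (stepMean G P q)^[t] (fun J => c * F J) I = c * (stepMean G P q)^[t] F I := by
  induction t generalizing I with
  | zero => rfl
  | succ t ih =>
    rw [Function.iterate_succ_apply', stepMean_congr fun J _ => ih, stepMean_const_mul,
      Function.iterate_succ_apply']

theorem iterate_stepMean_add (t : ℕ) :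
    (stepMean G P q)^[t] (fun J => F J + F' J) I =
      (stepMean G P q)^[t] F I + (stepMean G P q)^[t] F' I := by
  induction t generalizing I with
  | zero => rfl
  | succ t ih =>
    rw [Function.iterate_succ_apply', stepMean_congr fun J _ => ih, stepMean_add,
      Function.iterate_succ_apply', Function.iterate_succ_apply']

/-- A function that contracts by the factor `ρ` in every round, on an upward closed family. -/
theorem iterate_stepMean_le_pow {A : Finset V → Prop} (hA : ∀ I J, I ⊆ J → A I → A J) {ρ : ℝ}
    (hρ : 0 ≤ ρ) (hF : ∀ I, A I → stepMean G P q F I ≤ ρ * F I) (hI : A I) (t : ℕ) :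
    (stepMean G P q)^[t] F I ≤ ρ ^ t * F I := by
  induction t generalizing I with
  | zero => simp
  | succ t ih =>
    rw [Function.iterate_succ_apply']
    calc stepMean G P q ((stepMean G P q)^[t] F) I
        ≤ stepMean G P q (fun J => ρ ^ t * F J) I :=
          stepMean_mono fun J hJ => ih (hA I J hJ hI)
      _ = ρ ^ t * stepMean G P q F I := stepMean_const_mul _
      _ ≤ ρ ^ t * (ρ * F I) := by gcongr; exact hF I hI
      _ = _ := by ring

/-- It chains phases: with `F` the failure probability of the later phases, the total failure is at
most `b` plus the probability of missing the milestone `A`. -/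
theorem iterate_stepMean_le_add {A : Finset V → Prop} [DecidablePred A] {b : ℝ} (hb : 0 ≤ b)
    (hF : ∀ J, I ⊆ J → F J ≤ 1) (hFA : ∀ J, I ⊆ J → A J → F J ≤ b) (t : ℕ) :
    (stepMean G P q)^[t] F I ≤ b + (stepMean G P q)^[t] (fun J => if A J then 0 else 1) I := by
  rw [← iterate_stepMean_const (G := G) (P := P) (q := q) (I := I) t b, ← iterate_stepMean_add]
  refine iterate_stepMean_mono t fun J hJ => ?_
  split_ifs with h
  · rw [add_zero]; exact hFA J hJ h
  · linarith [hF J hJ]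

theorem iterate_stepMean_le_one (hF : ∀ J, F J ≤ 1) (t : ℕ) : (stepMean G P q)^[t] F I ≤ 1 :=
  (iterate_stepMean_mono t fun J _ => hF J).trans_eq (iterate_stepMean_const t 1)

theorem card_add_card_compl_cast (J : Finset V) :
    (J.card : ℝ) + Jᶜ.card = Fintype.card V := by
  exact_mod_cast J.card_add_card_compl

/-- The expected number of informed vertices grows at most by the factor `1 + c (1 + η)`. -/
theorem IsQuasirandom.iterate_stepMean_card_le {η : ℝ} (h : IsQuasirandom G η) (t : ℕ) :
    (stepMean G P q)^[t] (fun J => (J.card : ℝ)) I ≤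
      (1 + growthRate P q * (1 + η)) ^ t * I.card := by
  have hc := growthRate_nonneg P q.2
  have hη := h.eta_pos
  refine iterate_stepMean_le_pow (A := fun _ => True) (fun _ _ _ _ => trivial) (by positivity)
    (fun I _ => ?_) trivial t
  have h1 : stepMean G P q (fun J => (J.card : ℝ)) I =
      Fintype.card V - stepMean G P q (fun J => (Jᶜ.card : ℝ)) I := by
    rw [← stepMean_const (G := G) (P := P) (q := q) (I := I) (Fintype.card V : ℝ), ← stepMean_sub]
    exact stepMean_congr fun J _ => by linarith [card_add_card_compl_cast J]
  rw [h1, stepMean_card_compl h.degree_pos]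
  have := h.card_compl_sub_meanStay_le (P := P) (q := q) (I := I)
  linarith [card_add_card_compl_cast I]

/-- If every uninformed vertex stays uninformed with probability at least `p₀` in every round, then
it is unlikely that all vertices are informed before `|Iᶜ| p₁ ^ t` is small, where `p₁ < p₀`. -/
theorem iterate_stepMean_eq_univ_le (hG : ∀ w, 0 < G.degree w) {p₀ p₁ m : ℝ} (hp1 : 0 < p₁)
    (hp : p₁ < p₀) (hp0 : p₀ ≤ 1) (hm : 0 < m) (hstay : ∀ I u, u ∉ I → p₀ ≤ stayProb G P q I u)
    (t : ℕ) (hI : m ≤ Iᶜ.card * p₁ ^ t) :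
    (stepMean G P q)^[t] (fun J => if J = Finset.univ then 1 else 0) I ≤
      t / ((p₀ - p₁) ^ 2 * m) := by
  have hw : 0 < p₀ - p₁ := sub_pos.2 hp
  induction t generalizing I with
  | zero =>
    have : I ≠ Finset.univ := by
      rintro rfl
      simp at hI
      linarith
    simp [this]
  | succ t ih =>
    rw [Function.iterate_succ_apply']
    set l : ℝ := (Iᶜ.card : ℝ) with hl
    set w := p₀ - p₁
    have hml : m ≤ l := hI.trans
      (mul_le_of_le_one_right (Nat.cast_nonneg _) (pow_le_one₀ hp1.le (by linarith)))
    have hl0 : 0 < l := hm.trans_le hml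
    have hmean : p₀ * l ≤ meanStay G P q I := by
      rw [mul_comm, hl, ← nsmul_eq_mul]
      exact Finset.card_nsmul_le_sum _ _ _ fun u hu => hstay I u (by simpa using hu)
    have hvar : stepMean G P q (fun J => ((Jᶜ.card : ℝ) - meanStay G P q I) ^ 2) I ≤ l := by
      refine (stepMean_variance_le hG).trans ?_
      calc ∑ u ∈ Iᶜ, stayProb G P q I u * (1 - stayProb G P q I u) ≤ ∑ u ∈ Iᶜ, (1 : ℝ) := by
            refine Finset.sum_le_sum fun u hu => ?_
            have := stayProb_mem_Icc (P := P) (q := q) hG (I := I) (u := u) (by simpa using hu)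
            nlinarith [this.1, this.2]
        _ = l := by simp [hl]
    calc stepMean G P q ((stepMean G P q)^[t] fun J => if J = Finset.univ then 1 else 0) I
        -- If at least `p₁ l` vertices stay uninformed, the invariant `m ≤ |Jᶜ| p₁ ^ t` persists and
        -- induction applies. Otherwise the deviation from the mean exceeds `w l`, and Chebyshev
        -- charges at most `1 / (w² l)` for it.
        ≤ stepMean G P q (fun J => t / (w ^ 2 * m) +
            1 / (w * l) ^ 2 * ((Jᶜ.card : ℝ) - meanStay G P q I) ^ 2) I := by
          refine stepMean_mono fun J _ => ?_
          by_cases hJ : p₁ * l ≤ Jᶜ.card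
          · refine (ih ?_).trans (le_add_of_nonneg_right (by positivity))
            refine hI.trans ?_
            rw [pow_succ', ← mul_assoc, mul_comm l]
            gcongr
          · refine (iterate_stepMean_le_one (fun J => by split_ifs <;> norm_num) t).trans ?_
            have h1 : (w * l) ^ 2 ≤ ((Jᶜ.card : ℝ) - meanStay G P q I) ^ 2 := by
              rw [← neg_sq ((Jᶜ.card : ℝ) - _)]
              push Not at hJ
              have : w * l = p₀ * l - p₁ * l := by simp only [w]; ring
              gcongr
              linarith
            have h2 : 1 ≤ 1 / (w * l) ^ 2 * ((Jᶜ.card : ℝ) - meanStay G P q I) ^ 2 := by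
              rw [one_div, ← div_eq_inv_mul, one_le_div (by positivity)]
              exact h1
            have h3 : 0 ≤ (t : ℝ) / (w ^ 2 * m) := by positivity
            linarith
      _ ≤ t / (w ^ 2 * m) + 1 / (w * l) ^ 2 * l := by
          rw [stepMean_add, stepMean_const, stepMean_const_mul]
          gcongr
      _ = t / (w ^ 2 * m) + 1 / (w ^ 2 * l) := by
          congr 1
          field_simp
      _ ≤ t / (w ^ 2 * m) + 1 / (w ^ 2 * m) := by gcongr
      _ = _ := by push_cast; ring

/-- The Markov inequality for the number of uninformed vertices. -/
theorem iterate_stepMean_not_le {A : Finset V → Prop} (hA : ∀ I J, I ⊆ J → A I → A J) {ρ x : ℝ}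
    (hρ : 0 ≤ ρ) (hx : 0 < x) (hG : ∀ w, 0 < G.degree w)
    (hstep : ∀ I, A I → meanStay G P q I ≤ ρ * Iᶜ.card) (hI : A I) (t : ℕ)
    {p : Finset V → Prop} [DecidablePred p] (hp : ∀ J, ¬ p J → x ≤ Jᶜ.card) :
    (stepMean G P q)^[t] (fun J => if p J then 0 else 1) I ≤ ρ ^ t * (Fintype.card V / x) := by
  have h1 : (stepMean G P q)^[t] (fun J => (Jᶜ.card : ℝ)) I ≤ ρ ^ t * Iᶜ.card :=
    iterate_stepMean_le_pow hA hρ (fun I hI => by rw [stepMean_card_compl hG]; exact hstep I hI) hI t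
  calc (stepMean G P q)^[t] (fun J => if p J then 0 else 1) I
      ≤ (stepMean G P q)^[t] (fun J => 1 / x * (Jᶜ.card : ℝ)) I := by
        refine iterate_stepMean_mono t fun J _ => ?_
        split_ifs with hJ
        · positivity
        · rw [one_div, ← div_eq_inv_mul, one_le_div hx]; exact hp J hJ
    _ = 1 / x * (stepMean G P q)^[t] (fun J => (Jᶜ.card : ℝ)) I := iterate_stepMean_const_mul _ _
    _ ≤ 1 / x * (ρ ^ t * Fintype.card V) := by
        gcongr
        refine h1.trans ?_
        gcongr
        exact Finset.card_le_univ _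
    _ = _ := by ring

end Chain

/-! ### The startup phase: a contracting negative moment of the informed set. -/

/-- A decreasing weight: `j ^ (-s)` for `j ≥ K`, with an extra factor `2` for each step below
`K`. -/
noncomputable def startWeight (K : ℕ) (s : ℝ) (j : ℕ) : ℝ :=
  2 ^ (K - j) * ((max j K : ℕ) : ℝ) ^ (-s)

section StartWeight

variable {K : ℕ} {s : ℝ} {i j : ℕ}

theorem startWeight_nonneg : 0 ≤ startWeight K s j := by
  unfold startWeight; positivity

theorem rpow_max_anti (hK : 1 ≤ K) (hs : 0 < s) (hij : i ≤ j) :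
    ((max j K : ℕ) : ℝ) ^ (-s) ≤ ((max i K : ℕ) : ℝ) ^ (-s) := by
  refine Real.rpow_le_rpow_of_nonpos ?_ ?_ (by linarith)
  · exact_mod_cast lt_of_lt_of_le hK (le_max_right _ _)
  · exact_mod_cast max_le_max_right _ hij

theorem startWeight_anti (hK : 1 ≤ K) (hs : 0 < s) (hij : i ≤ j) :
    startWeight K s j ≤ startWeight K s i := by
  unfold startWeight
  have := rpow_max_anti hK hs hij
  gcongr
  norm_num

/-- Below `K` there is no useful concentration; the powers of `2` make any growth at all halve the
weight. -/
theorem startWeight_le_half (hK : 1 ≤ K) (hs : 0 < s) (hij : i < j) (hiK : i < K) :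
    startWeight K s j ≤ startWeight K s i * (1 / 2) := by
  unfold startWeight
  have h1 := rpow_max_anti hK hs hij.le
  have h2 : (2 : ℝ) ^ (K - j) * 2 ≤ 2 ^ (K - i) := by
    rw [← pow_succ]
    exact pow_le_pow_right₀ (by norm_num) (by omega)
  have h3 : (0 : ℝ) ≤ ((max i K : ℕ) : ℝ) ^ (-s) := by positivity
  calc (2 : ℝ) ^ (K - j) * ((max j K : ℕ) : ℝ) ^ (-s)
      ≤ (2 : ℝ) ^ (K - j) * ((max i K : ℕ) : ℝ) ^ (-s) := by gcongr
    _ = ((2 : ℝ) ^ (K - j) * 2) * ((max i K : ℕ) : ℝ) ^ (-s) * (1 / 2) := by ring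
    _ ≤ _ := by gcongr

theorem startWeight_of_le (hKj : K ≤ j) : startWeight K s j = (j : ℝ) ^ (-s) := by
  simp [startWeight, hKj]

theorem rpow_le_startWeight (hK : 1 ≤ K) (hs : 0 < s) {n : ℕ} (hn : 1 ≤ n) (hjn : j ≤ n) :
    ((K : ℝ) * n) ^ (-s) ≤ startWeight K s j := by
  have hmax : ((max j K : ℕ) : ℝ) ≤ (K : ℝ) * n := by
    have : max j K ≤ K * n := max_le (hjn.trans (Nat.le_mul_of_pos_left n hK))
      (Nat.le_mul_of_pos_right K hn)
    exact_mod_cast this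
  have h0 : (0 : ℝ) < ((max j K : ℕ) : ℝ) := by
    exact_mod_cast lt_of_lt_of_le hK (le_max_right _ _)
  refine (Real.rpow_le_rpow_of_nonpos h0 hmax (by linarith)).trans ?_
  exact le_mul_of_one_le_left (by positivity) (one_le_pow₀ (by norm_num))

theorem startWeight_one_le (hK : 1 ≤ K) (hs : 0 < s) : startWeight K s 1 ≤ 2 ^ K := by
  unfold startWeight
  have h1 : ((max 1 K : ℕ) : ℝ) ^ (-s) ≤ 1 :=
    Real.rpow_le_one_of_one_le_of_nonpos (by exact_mod_cast le_max_left 1 K) (by linarith)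
  calc (2 : ℝ) ^ (K - 1) * ((max 1 K : ℕ) : ℝ) ^ (-s) ≤ 2 ^ K * 1 := by
        gcongr
        · norm_num
        · omega
    _ = _ := mul_one _

end StartWeight

section Startup

set_option linter.unusedSectionVars false

variable {V : Type*} [Fintype V] [DecidableEq V] [MeasurableSpace V] [MeasurableSingletonClass V]
  {G : SimpleGraph V} [DecidableRel G.Adj] {P : Protocol} {q : unitInterval} {I : Finset V} {η : ℝ}

variable (V η) in
/-- The weight of a set of at most `η n` informed vertices. -/
noncomputable def startPotential (K : ℕ) (s : ℝ) (I : Finset V) : ℝ :=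
  if (I.card : ℝ) ≤ η * Fintype.card V then startWeight K s I.card else 0

theorem startPotential_nonneg {K : ℕ} {s : ℝ} : 0 ≤ startPotential V η K s I := by
  unfold startPotential
  split_ifs
  · exact startWeight_nonneg
  · exact le_rfl

theorem startPotential_le {K : ℕ} {s : ℝ} : startPotential V η K s I ≤ startWeight K s I.card := by
  unfold startPotential
  split_ifs
  · exact le_rfl
  · exact startWeight_nonneg

theorem IsQuasirandom.stepMean_newly_variance_le (h : IsQuasirandom G η) (hη : η ≤ 1 / 2) :
    stepMean G P q (fun J => (((J.card : ℝ) - I.card) - ((Iᶜ.card : ℝ) - meanStay G P q I)) ^ 2) I ≤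
      4 * I.card := by
  have h1 : stepMean G P q
      (fun J => (((J.card : ℝ) - I.card) - ((Iᶜ.card : ℝ) - meanStay G P q I)) ^ 2) I =
      stepMean G P q (fun J => ((Jᶜ.card : ℝ) - meanStay G P q I) ^ 2) I := by
    refine stepMean_congr fun J _ => ?_
    rw [show (J.card : ℝ) - I.card - ((Iᶜ.card : ℝ) - meanStay G P q I) =
      -((Jᶜ.card : ℝ) - meanStay G P q I) by
        linarith [card_add_card_compl_cast J, card_add_card_compl_cast I], neg_sq]
  rw [h1]
  refine (stepMean_variance_le h.degree_pos).trans ?_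
  have h2 : ∑ u ∈ Iᶜ, stayProb G P q I u * (1 - stayProb G P q I u) ≤
      ∑ u ∈ Iᶜ, (1 - stayProb G P q I u) := by
    refine Finset.sum_le_sum fun u hu => ?_
    have := stayProb_mem_Icc (P := P) (q := q) h.degree_pos (I := I) (u := u) (by simpa using hu)
    exact mul_le_of_le_one_left (by linarith [this.2]) this.2
  rw [← card_compl_sub_meanStay] at h2
  refine h2.trans (h.card_compl_sub_meanStay_le.trans ?_)
  have hc := growthRate_nonneg P q.2
  have hc2 := growthRate_le P q.2
  gcongr
  nlinarith

theorem IsQuasirandom.stepMean_newly (h : IsQuasirandom G η) :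
    stepMean G P q (fun J => (J.card : ℝ) - I.card) I = (Iᶜ.card : ℝ) - meanStay G P q I := by
  rw [← stepMean_card_compl h.degree_pos,
    ← stepMean_const (G := G) (P := P) (q := q) (I := I) (Iᶜ.card : ℝ), ← stepMean_sub]
  exact stepMean_congr fun J _ => by
    linarith [card_add_card_compl_cast J, card_add_card_compl_cast I]

/-- For `|I| ≥ K`, Chebyshev gives growth by a factor `1 + b` except with probability at most `4 /
(w² K)`. For `|I| < K`, first and second moments show that growth occurs with probability bounded
below. Each case yields one of the two conditions on `ρ`. -/
theorem IsQuasirandom.stepMean_startPotential_le (h : IsQuasirandom G η) (hη : η ≤ 1 / 2)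
    {b w s ρ : ℝ} {K : ℕ} (hK : 1 ≤ K) (hs : 0 < s) (hb : 0 ≤ b) (hw : 0 < w)
    (hbw : b + w ≤ growthRate P q * (1 - √(2 * η) - 3 * η))
    (hρ1 : (1 + b) ^ (-s) + 4 / (w ^ 2 * K) ≤ ρ) (hρ2 : 1 - (b + w) ^ 2 / 40 ≤ ρ)
    (hI : I.Nonempty) :
    stepMean G P q (startPotential V η K s) I ≤ ρ * startPotential V η K s I := by
  by_cases hIη : (I.card : ℝ) ≤ η * Fintype.card V
  swap
  · have h0 : ∀ J, I ⊆ J → startPotential V η K s J = 0 := fun J hJ => by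
      have : (I.card : ℝ) ≤ J.card := Nat.cast_le.2 (Finset.card_le_card hJ)
      rw [startPotential, if_neg (by linarith)]
    rw [stepMean_congr h0, stepMean_const, h0 I subset_rfl, mul_zero]
  have hmean := h.le_card_compl_sub_meanStay (P := P) (q := q) hη hIη
  have hvar := h.stepMean_newly_variance_le (P := P) (q := q) (I := I) hη
  have hnew := h.stepMean_newly (P := P) (q := q) (I := I)
  have hmean2 : (Iᶜ.card : ℝ) - meanStay G P q I ≤ 4 * I.card := by
    refine h.card_compl_sub_meanStay_le.trans ?_
    have hc := growthRate_nonneg P q.2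
    have hc2 := growthRate_le P q.2
    gcongr
    nlinarith
  have hfI : startPotential V η K s I = startWeight K s I.card := by
    rw [startPotential, if_pos hIη]
  rw [hfI]
  have hcard : 1 ≤ I.card := hI.card_pos
  set μ : ℝ := (Iᶜ.card : ℝ) - meanStay G P q I
  set k : ℝ := (I.card : ℝ) with hk
  have hk1 : 1 ≤ k := Nat.one_le_cast.2 hcard
  have hμ : (b + w) * k ≤ μ := by
    refine le_trans ?_ hmean
    calc (b + w) * k ≤ growthRate P q * (1 - √(2 * η) - 3 * η) * k := by gcongr
      _ = _ := by ring
  have hf0 : 0 ≤ startWeight K s I.card := startWeight_nonneg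
  set f₀ := startWeight K s I.card with hf₀
  by_cases hkK : K ≤ I.card
  · calc stepMean G P q (startPotential V η K s) I
        ≤ stepMean G P q (fun J => f₀ * (1 + b) ^ (-s) +
            f₀ / (w * k) ^ 2 * (((J.card : ℝ) - k) - μ) ^ 2) I := by
          refine stepMean_mono fun J hJ => startPotential_le.trans ?_
          have hJI : I.card ≤ J.card := Finset.card_le_card hJ
          by_cases hJb : b * k ≤ (J.card : ℝ) - k
          · refine le_trans ?_ (le_add_of_nonneg_right (by positivity))
            rw [startWeight_of_le (hkK.trans hJI), hf₀, startWeight_of_le hkK, ← hk,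
              ← Real.mul_rpow (by linarith) (by linarith)]
            refine Real.rpow_le_rpow_of_nonpos (by positivity) ?_ (by linarith)
            linarith
          · refine (startWeight_anti hK hs hJI).trans ?_
            have h1 : (w * k) ^ 2 ≤ ((J.card : ℝ) - k - μ) ^ 2 := by
              rw [← neg_sq ((J.card : ℝ) - k - μ)]
              push Not at hJb
              gcongr
              linarith
            have h2 : f₀ ≤ f₀ / (w * k) ^ 2 * ((J.card : ℝ) - k - μ) ^ 2 := by
              rw [div_mul_eq_mul_div, le_div_iff₀ (by positivity)]
              gcongr
            have h3 : 0 ≤ f₀ * (1 + b) ^ (-s) := by positivity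
            linarith
      _ ≤ f₀ * (1 + b) ^ (-s) + f₀ / (w * k) ^ 2 * (4 * k) := by
          rw [stepMean_add, stepMean_const, stepMean_const_mul]
          gcongr
      _ = f₀ * ((1 + b) ^ (-s) + 4 / (w ^ 2 * k)) := by field_simp
      _ ≤ f₀ * ((1 + b) ^ (-s) + 4 / (w ^ 2 * K)) := by
          have : (K : ℝ) ≤ k := Nat.cast_le.2 hkK
          have : (0 : ℝ) < K := by exact_mod_cast hK
          gcongr
      _ ≤ f₀ * ρ := by gcongr
      _ = _ := mul_comm _ _
  · push Not at hkK
    -- The minimiser of `-τ (b + w) k + τ² / 2 * (20 k²)`; the minimum is `-(b + w)² / 40`.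
    set τ := (b + w) / (20 * k) with hτ
    have hsq : stepMean G P q (fun J => ((J.card : ℝ) - k) ^ 2) I ≤ 20 * k ^ 2 := by
      have h1 : stepMean G P q (fun J => ((J.card : ℝ) - k) ^ 2) I =
          stepMean G P q (fun J => ((J.card : ℝ) - k - μ) ^ 2) I + 2 * μ * μ - μ ^ 2 := by
        have h2 : stepMean G P q (fun J => ((J.card : ℝ) - k) ^ 2) I =
            stepMean G P q (fun J => (((J.card : ℝ) - k - μ) ^ 2 + 2 * μ * ((J.card : ℝ) - k)) +
              -μ ^ 2) I := stepMean_congr fun J _ => by ring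
        rw [h2, stepMean_add, stepMean_add, stepMean_const_mul, hnew, stepMean_const]
        ring
      have hμ0 : 0 ≤ μ := le_trans (by positivity) hμ
      rw [h1]
      nlinarith
    calc stepMean G P q (startPotential V η K s) I
        ≤ stepMean G P q (fun J => (f₀ + -(f₀ * τ) * ((J.card : ℝ) - k)) +
            f₀ * τ ^ 2 / 2 * ((J.card : ℝ) - k) ^ 2) I := by
          refine stepMean_mono fun J hJ => startPotential_le.trans ?_
          have hJI : I.card ≤ J.card := Finset.card_le_card hJ
          rcases hJI.eq_or_lt with he | hlt
          · rw [← he, ← hk, sub_self]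
            simp [hf₀]
          · refine (startWeight_le_half hK hs hlt hkK).trans ?_
            -- With `X = |J| - k`, the quadratic `1 - τ X + τ² X² / 2` equals `1` at `X = 0` and is
            -- at least `1 / 2` everywhere, so it dominates the relative weight.
            have : (f₀ + -(f₀ * τ) * ((J.card : ℝ) - k)) +
              f₀ * τ ^ 2 / 2 * ((J.card : ℝ) - k) ^ 2 =
                f₀ * (1 / 2) + f₀ / 2 * (τ * ((J.card : ℝ) - k) - 1) ^ 2 := by ring
            rw [this]
            exact le_add_of_nonneg_right (by positivity)
      _ ≤ (f₀ + -(f₀ * τ) * μ) + f₀ * τ ^ 2 / 2 * (20 * k ^ 2) := by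
          rw [stepMean_add, stepMean_add, stepMean_const, stepMean_const_mul, stepMean_const_mul,
            hnew]
          gcongr
      _ ≤ (f₀ + -(f₀ * τ) * ((b + w) * k)) + f₀ * τ ^ 2 / 2 * (20 * k ^ 2) := by
          have : f₀ * τ * ((b + w) * k) ≤ f₀ * τ * μ := by gcongr
          linarith
      _ = (1 - (b + w) ^ 2 / 40) * f₀ := by
          rw [hτ]
          field_simp
          ring
      _ ≤ ρ * f₀ := by gcongr

/-- Markov's inequality for the potential: below the threshold it is at least `(K n) ^ (-s)`, and
initially it is at most `2 ^ K`. -/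
theorem IsQuasirandom.iterate_stepMean_card_le_startup (h : IsQuasirandom G η) (hη : η ≤ 1 / 2)
    {b w s ρ : ℝ} {K : ℕ} (hK : 1 ≤ K) (hs : 0 < s) (hb : 0 ≤ b) (hw : 0 < w)
    (hbw : b + w ≤ growthRate P q * (1 - √(2 * η) - 3 * η))
    (hρ1 : (1 + b) ^ (-s) + 4 / (w ^ 2 * K) ≤ ρ) (hρ2 : 1 - (b + w) ^ 2 / 40 ≤ ρ) (v : V) (t : ℕ) :
    (stepMean G P q)^[t] (fun J => if η * Fintype.card V < J.card then 0 else 1) {v} ≤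
      ((K : ℝ) * Fintype.card V) ^ s * (ρ ^ t * 2 ^ K) := by
  have hρ0 : 0 ≤ ρ := le_trans (by positivity) hρ1
  have hV : Nonempty V := ⟨v⟩
  have hn : 1 ≤ Fintype.card V := Fintype.card_pos
  have hKn : (0 : ℝ) < (K : ℝ) * Fintype.card V := by
    have : (0 : ℝ) < K := by exact_mod_cast hK
    have : (0 : ℝ) < Fintype.card V := by exact_mod_cast hn
    positivity
  have h1 : (stepMean G P q)^[t] (startPotential V η K s) {v} ≤
      ρ ^ t * startPotential V η K s {v} :=
    iterate_stepMean_le_pow (A := fun I => I.Nonempty) (fun I J hIJ hI => hI.mono hIJ) hρ0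
      (fun I hI => h.stepMean_startPotential_le hη hK hs hb hw hbw hρ1 hρ2 hI)
      (Finset.singleton_nonempty v) t
  have h2 : startPotential V η K s {v} ≤ 2 ^ K := by
    refine startPotential_le.trans ?_
    rw [Finset.card_singleton]
    exact startWeight_one_le hK hs
  calc (stepMean G P q)^[t] (fun J => if η * Fintype.card V < J.card then 0 else 1) {v}
      ≤ (stepMean G P q)^[t]
          (fun J => ((K : ℝ) * Fintype.card V) ^ s * startPotential V η K s J) {v} := by
        refine iterate_stepMean_mono t fun J _ => ?_
        split_ifs with hJ
        · exact mul_nonneg (by positivity) startPotential_nonneg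
        · rw [startPotential, if_pos (not_lt.1 hJ)]
          have h3 := rpow_le_startWeight (s := s) hK hs hn J.card_le_univ
          calc (1 : ℝ) = ((K : ℝ) * Fintype.card V) ^ s * ((K : ℝ) * Fintype.card V) ^ (-s) := by
                rw [← Real.rpow_add hKn, add_neg_cancel, Real.rpow_zero]
            _ ≤ _ := by gcongr
    _ = ((K : ℝ) * Fintype.card V) ^ s * (stepMean G P q)^[t] (startPotential V η K s) {v} :=
        iterate_stepMean_const_mul _ _
    _ ≤ _ := by
        gcongr
        exact h1.trans (by gcongr)

end Startup

/-! ### The runtime constant in terms of the rates, and limits in `n`. -/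

theorem shrinkRate_nonneg (P : Protocol) {q : ℝ} (hq : q ∈ Set.Icc (0 : ℝ) 1) :
    0 ≤ shrinkRate P q :=
  mul_nonneg (sub_nonneg.2 (pullRate_mem_Icc P hq).2) (Real.exp_pos _).le

theorem shrinkRate_lt_one (P : Protocol) {q : ℝ} (hq0 : 0 < q) :
    shrinkRate P q < 1 := by
  have h1 : Real.exp (-q) < 1 := Real.exp_lt_one_iff.2 (by linarith)
  have h2 := Real.exp_pos (-q)
  cases P <;> simp only [shrinkRate, pullRate, pushRate]
  · linarith
  · simp [hq0]
  · nlinarith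

/-- For `q = 1` in pull and push&pull, `shrinkRate` is `0`; the conventions `log 0 = 0` and `1 / 0 =
0` then make the second term vanish, in agreement with the limit. -/
theorem runtimeConst_eq (P : Protocol) {q : ℝ} (hq1 : q ≤ 1) :
    runtimeConst P q = 1 / Real.log (1 + growthRate P q) + 1 / -Real.log (shrinkRate P q) := by
  rcases hq1.eq_or_lt with rfl | hq
  · cases P <;> simp [runtimeConst, growthRate, shrinkRate, pushRate, pullRate] <;> norm_num
  · have h1 : Real.log ((1 - q) * Real.exp (-q)) = Real.log (1 - q) - q := by
      rw [Real.log_mul (by linarith) (Real.exp_pos _).ne', Real.log_exp]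
      ring
    cases P
    · simp [runtimeConst, growthRate, shrinkRate, pushRate, pullRate]
    · simp only [runtimeConst, growthRate, shrinkRate, pushRate, pullRate, hq.ne, if_false,
        zero_add, neg_zero, Real.exp_zero, mul_one, div_neg, sub_eq_add_neg]
    · simp only [runtimeConst, growthRate, shrinkRate, pushRate, pullRate, hq.ne, if_false, h1,
        neg_sub, two_mul]

theorem log_one_add_growthRate_pos (P : Protocol) {q : ℝ} (hq : 0 < q) :
    0 < Real.log (1 + growthRate P q) :=
  Real.log_pos (by linarith [growthRate_pos P hq])

section Limits

theorem tendsto_log_natCast : Tendsto (fun n : ℕ => Real.log n) atTop atTop :=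
  Real.tendsto_log_atTop.comp tendsto_natCast_atTop_atTop

theorem tendsto_exp_neg_mul_log {κ : ℝ} (hκ : 0 < κ) :
    Tendsto (fun n : ℕ => Real.exp (-(κ * Real.log n))) atTop (𝓝 0) :=
  Real.tendsto_exp_neg_atTop_nhds_zero.comp (tendsto_log_natCast.const_mul_atTop hκ)

/-- The number of rounds `⌈τ log n⌉`. -/
noncomputable def logRounds (τ : ℝ) (n : ℕ) : ℕ := ⌈τ * Real.log n⌉₊

theorem le_logRounds (τ : ℝ) (n : ℕ) : τ * Real.log n ≤ logRounds τ n := Nat.le_ceil _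

theorem logRounds_le {τ : ℝ} (hτ : 0 ≤ τ) (n : ℕ) :
    (logRounds τ n : ℝ) ≤ τ * Real.log n + 1 :=
  (Nat.ceil_lt_add_one (mul_nonneg hτ (Real.log_natCast_nonneg n))).le

theorem tendsto_logRounds {τ : ℝ} (hτ : 0 < τ) : Tendsto (logRounds τ) atTop atTop :=
  tendsto_nat_ceil_atTop.comp (tendsto_log_natCast.const_mul_atTop hτ)

/-- If `ρ < exp (-1 / τ)`, then `n ρ ^ (τ log n)` vanishes. -/
theorem tendsto_pow_logRounds_mul {ρ τ : ℝ} (hρ0 : 0 < ρ) (hτ : 0 < τ)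
    (hρ : ρ < Real.exp (-(1 / τ))) :
    Tendsto (fun n : ℕ => ρ ^ logRounds τ n * n) atTop (𝓝 0) := by
  have hlog : Real.log ρ < -(1 / τ) := by rwa [Real.log_lt_iff_lt_exp hρ0]
  have hκ : 0 < -Real.log ρ * τ - 1 := by
    have : 1 / τ * τ < -Real.log ρ * τ := by gcongr; linarith
    rw [one_div_mul_cancel hτ.ne'] at this
    linarith
  refine squeeze_zero' (Eventually.of_forall fun n => by positivity) ?_
    (tendsto_exp_neg_mul_log hκ)
  filter_upwards [eventually_ge_atTop 1] with n hn
  have hn0 : (0 : ℝ) < n := by exact_mod_cast hn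
  have h1 : ρ ^ logRounds τ n = Real.exp (logRounds τ n * Real.log ρ) := by
    rw [Real.exp_nat_mul, Real.exp_log hρ0]
  have h2 : (n : ℝ) = Real.exp (Real.log n) := (Real.exp_log hn0).symm
  have h3 : (logRounds τ n : ℝ) * Real.log ρ ≤ (τ * Real.log n) * Real.log ρ :=
    mul_le_mul_of_nonpos_right (le_logRounds τ n)
      (hlog.le.trans (by rw [neg_nonpos]; positivity))
  calc ρ ^ logRounds τ n * n = Real.exp (logRounds τ n * Real.log ρ + Real.log n) := by
        rw [h1, Real.exp_add, ← h2]
    _ ≤ _ := Real.exp_le_exp.2 (by linarith)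

end Limits

/-! ### Choice of the startup parameters. -/

section Startup

variable {P : Protocol} {q : unitInterval}

/-- The exponent `s` may be tiny: it multiplies both `log n` and the decay `L t`, so the bound
vanishes once `t` exceeds `(1 + δ) log n / L` for a fixed `δ > 0`, whatever `s` is. -/
theorem exists_startup_bound (hq : 0 < (q : ℝ)) {L : ℝ} (hL0 : 0 < L)
    (hL : L < Real.log (1 + growthRate P q)) :
    ∃ η : ℝ, 0 < η ∧ η ≤ 1 / 2 ∧ ∃ s C : ℝ, 0 < s ∧ ∀ (n : ℕ) (G : SimpleGraph (Fin n))
      [DecidableRel G.Adj], IsQuasirandom G η → ∀ (v : Fin n) (t : ℕ),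
      (stepMean G P q)^[t] (fun J => if η * n < J.card then 0 else 1) {v} ≤
        C * ((n : ℝ) ^ s * Real.exp (-(s * L)) ^ t) := by
  set c := growthRate P q with hc
  have hc0 : 0 < c := growthRate_pos P hq
  obtain ⟨M, hLM, hMc⟩ := exists_between hL
  set b := Real.exp M - 1 with hb
  have hb0 : 0 < b := by
    have := Real.add_one_lt_exp (hL0.trans hLM).ne'
    linarith
  have hbc : b < c := by
    have := (Real.lt_log_iff_exp_lt (by linarith)).1 hMc
    linarith
  set w := (c - b) / 2 with hw
  have hw0 : 0 < w := by linarith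
  obtain ⟨η, hη0, hη⟩ : ∃ η : ℝ, 0 < η ∧ (η ≤ 1 / 2 ∧ b + w ≤ c * (1 - √(2 * η) - 3 * η)) := by
    have hcont : Tendsto (fun η : ℝ => c * (1 - √(2 * η) - 3 * η)) (𝓝 0) (𝓝 c) :=
      Continuous.tendsto' (by fun_prop) _ _ (by simp)
    have h1 : ∀ᶠ η : ℝ in 𝓝 0, η ≤ 1 / 2 ∧ b + w ≤ c * (1 - √(2 * η) - 3 * η) :=
      (eventually_le_nhds (by norm_num)).and
        (hcont.eventually (eventually_ge_nhds (by linarith)))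
    exact ((eventually_mem_nhdsWithin (a := (0 : ℝ)) (s := Set.Ioi 0)).and
      (h1.filter_mono nhdsWithin_le_nhds)).exists
  -- Small enough that the weak contraction below `K` still reaches `exp (-(s * L))`.
  set s := (b + w) ^ 2 / 40 / L with hs
  have hs0 : 0 < s := by positivity
  have hρ2 : 1 - (b + w) ^ 2 / 40 ≤ Real.exp (-(s * L)) := by
    have h1 : s * L = (b + w) ^ 2 / 40 := div_mul_cancel₀ _ hL0.ne'
    rw [h1]
    exact Real.one_sub_le_exp_neg _
  have hlt : (1 + b) ^ (-s) < Real.exp (-(s * L)) := by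
    rw [show 1 + b = Real.exp M by rw [hb]; ring, ← Real.exp_mul, Real.exp_lt_exp]
    nlinarith
  -- Since `(1 + b) ^ (-s) = exp (-s M)` with `M > L`, there is room for the Chebyshev error once
  -- `K` is large.
  obtain ⟨K, hK⟩ := exists_nat_gt (4 / (w ^ 2 * (Real.exp (-(s * L)) - (1 + b) ^ (-s))))
  have hK0 : (0 : ℝ) < K := lt_of_le_of_lt
    (div_nonneg (by norm_num) (mul_nonneg (sq_nonneg _) (sub_pos.2 hlt).le)) hK
  have hρ1 : (1 + b) ^ (-s) + 4 / (w ^ 2 * K) ≤ Real.exp (-(s * L)) := by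
    rw [div_lt_iff₀ (mul_pos (by positivity) (sub_pos.2 hlt))] at hK
    have : 4 / (w ^ 2 * K) ≤ Real.exp (-(s * L)) - (1 + b) ^ (-s) := by
      rw [div_le_iff₀ (by positivity)]
      linarith
    linarith
  refine ⟨η, hη0, hη.1, s, (K : ℝ) ^ s * 2 ^ K, hs0, fun n G _ hG v t => ?_⟩
  have h := hG.iterate_stepMean_card_le_startup (P := P) (q := q) hη.1 (K := K)
    (by exact_mod_cast hK0) hs0 hb0.le hw0 hη.2 hρ1 hρ2 v t
  rw [Fintype.card_fin, Real.mul_rpow hK0.le (Nat.cast_nonneg _)] at h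
  exact h.trans_eq (by ring)

end Startup

/-! ### Upper and lower tail bounds on expander sequences. -/

section Bounds

variable {G : ∀ n : ℕ, SimpleGraph (Fin n)} [∀ n, DecidableRel (G n).Adj]
  {P : Protocol} {q : unitInterval}

theorem IsExpanderSequence.eventually_startup (hG : IsExpanderSequence G) (hq : 0 < (q : ℝ)) {τ : ℝ}
    (hτ : 1 / Real.log (1 + growthRate P q) < τ) :
    ∃ η : ℝ, 0 < η ∧ η ≤ 1 / 2 ∧ ∀ ε > 0, ∀ᶠ n in atTop, ∀ v,
      (stepMean (G n) P q)^[logRounds τ n] (fun J => if η * n < J.card then 0 else 1) {v} ≤ ε := by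
  have hlog := log_one_add_growthRate_pos P hq
  have hτ0 : 0 < τ := lt_trans (by positivity) hτ
  have hτ' : 1 / τ < Real.log (1 + growthRate P q) := by rwa [one_div_lt hτ0 hlog]
  obtain ⟨L, hL1, hL2⟩ := exists_between hτ'
  have hL0 : 0 < L := lt_trans (by positivity) hL1
  obtain ⟨η, hη0, hη1, s, C, hs, hbound⟩ := exists_startup_bound hq hL0 hL2
  refine ⟨η, hη0, hη1, fun ε hε => ?_⟩
  have hκ : 0 < s * (L * τ - 1) := by
    rw [div_lt_iff₀ hτ0] at hL1
    exact mul_pos hs (by linarith)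
  have hlim := (tendsto_exp_neg_mul_log hκ).const_mul |C|
  rw [mul_zero] at hlim
  filter_upwards [hG.eventually_isQuasirandom hη0, hlim.eventually (eventually_le_nhds hε),
    eventually_ge_atTop 1] with n hn hle hn1 v
  refine (hbound n (G n) hn v _).trans (le_trans ?_ hle)
  have hn0 : (0 : ℝ) < n := by exact_mod_cast hn1
  refine mul_le_mul (le_abs_self C) ?_ (by positivity) (abs_nonneg C)
  rw [Real.rpow_def_of_pos hn0, ← Real.exp_nat_mul, ← Real.exp_add, Real.exp_le_exp]
  have h1 := mul_le_mul_of_nonneg_right (le_logRounds τ n) (mul_pos hs hL0).le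
  linarith

theorem IsExpanderSequence.eventually_not_univ_le (hG : IsExpanderSequence G) (hq : 0 < (q : ℝ))
    {τ ε : ℝ} (hτ : runtimeConst P q < τ) (hε : 0 < ε) :
    ∀ᶠ n in atTop, ∀ v, (processLaw (G n) q).real
      {ω | informed P v ω ⌊τ * Real.log n⌋₊ ≠ Finset.univ} ≤ ε := by
  rw [runtimeConst_eq P q.2.2] at hτ
  have hρ0 := shrinkRate_nonneg P q.2
  have hρ1 := shrinkRate_lt_one P hq
  have hlog := log_one_add_growthRate_pos P hq
  set ρ := shrinkRate P q
  have hB : 0 ≤ 1 / -Real.log ρ :=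
    one_div_nonneg.2 (neg_nonneg.2 (Real.log_nonpos hρ0 hρ1.le))
  -- Each of the three phases gets a quarter of the slack; the last quarter absorbs the rounding up
  -- of the three phase lengths.
  set gap := τ - (1 / Real.log (1 + growthRate P q) + 1 / -Real.log ρ) with hgap
  have hgap0 : 0 < gap := sub_pos.2 hτ
  set τ₁ := 1 / Real.log (1 + growthRate P q) + gap / 4 with hτ₁
  set τ₃ := 1 / -Real.log ρ + gap / 4 with hτ₃
  have hτ₁0 : 0 < τ₁ := by positivity
  have hτ₃0 : 0 < τ₃ := by positivity
  have hρτ : ρ < Real.exp (-(1 / τ₃)) := by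
    -- If `ρ = 0`, the last phase has length `gap / 4 * log n`, and any positive length would do.
    rcases hρ0.eq_or_lt with h0 | h0
    · rw [← h0]; exact Real.exp_pos _
    · have hlρ : 0 < -Real.log ρ := neg_pos.2 (Real.log_neg h0 hρ1)
      have h1 : 1 / τ₃ < -Real.log ρ := by
        rw [one_div_lt hτ₃0 hlρ]
        linarith
      rw [← Real.log_lt_iff_lt_exp h0]
      linarith
  obtain ⟨η₀, hη₀, hη₀1, hstart⟩ := hG.eventually_startup (P := P) hq
    (τ := τ₁) (by linarith)
  obtain ⟨η₁, hη₁, hη₁0, hη₁ρ⟩ : ∃ η : ℝ, 0 < η ∧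
      (η ≤ η₀ / 2 ∧ ρ + η + 2 * √(2 * η) < Real.exp (-(1 / τ₃))) := by
    have hcont : Tendsto (fun η : ℝ => ρ + η + 2 * √(2 * η)) (𝓝 0) (𝓝 ρ) :=
      Continuous.tendsto' (by fun_prop) _ _ (by simp)
    have h1 : ∀ᶠ η : ℝ in 𝓝 0, η ≤ η₀ / 2 ∧ ρ + η + 2 * √(2 * η) < Real.exp (-(1 / τ₃)) :=
      (eventually_le_nhds (by positivity)).and (hcont.eventually (eventually_lt_nhds hρτ))
    exact ((eventually_mem_nhdsWithin (a := (0 : ℝ)) (s := Set.Ioi 0)).and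
      (h1.filter_mono nhdsWithin_le_nhds)).exists
  set ρ₃ := ρ + η₁ + 2 * √(2 * η₁)
  have hρ₃ : 0 < ρ₃ := by positivity
  set ρ₂ := 1 - growthRate P q / 6 * (1 - √(1 - η₀ / 2)) with hρ₂
  have hs1 : √(1 - η₀ / 2) < 1 := by
    rw [Real.sqrt_lt' one_pos]
    linarith
  have hs0 : 0 ≤ √(1 - η₀ / 2) := Real.sqrt_nonneg _
  have hc := growthRate_pos P hq
  have hc2 := growthRate_le P q.2
  have hρ₂1 : ρ₂ < 1 := by
    have : 0 < growthRate P q / 6 * (1 - √(1 - η₀ / 2)) := mul_pos (by positivity) (by linarith)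
    linarith
  have hρ₂0 : 0 ≤ ρ₂ := by
    have : growthRate P q / 6 * (1 - √(1 - η₀ / 2)) ≤ 1 * 1 :=
      mul_le_mul (by linarith) (by linarith) (by linarith) one_pos.le
    linarith
  have hlim₂ : Tendsto (fun n => ρ₂ ^ logRounds (gap / 4) n * (1 / η₁)) atTop (𝓝 0) := by
    have := ((tendsto_pow_atTop_nhds_zero_of_lt_one hρ₂0 hρ₂1).comp
      (tendsto_logRounds (by positivity : 0 < gap / 4))).mul_const (1 / η₁)
    rwa [zero_mul] at this
  have hlim₃ := tendsto_pow_logRounds_mul hρ₃ hτ₃0 hη₁ρ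
  have hε3 : 0 < ε / 3 := by positivity
  filter_upwards [hstart _ hε3, hlim₂.eventually (eventually_le_nhds hε3),
    hlim₃.eventually (eventually_le_nhds hε3), hG.eventually_isQuasirandom hη₁,
    tendsto_log_natCast.eventually_ge_atTop (12 / gap), eventually_ge_atTop 1]
    with n hn₁ hn₂ hn₃ hQ hlarge hn1 v
  have hn0 : (0 : ℝ) < n := by exact_mod_cast hn1
  have hphase3 : ∀ I : Finset (Fin n), ((Iᶜ.card : ℕ) : ℝ) ≤ η₁ * n →
      (stepMean (G n) P q)^[logRounds τ₃ n] (fun J => if J = Finset.univ then 0 else 1) I ≤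
        ε / 3 := by
    intro I hI
    refine (iterate_stepMean_not_le (A := fun I => ((Iᶜ.card : ℕ) : ℝ) ≤ η₁ * n) (x := 1)
      ?_ hρ₃.le one_pos hQ.degree_pos ?_ hI _ ?_).trans (le_trans ?_ hn₃)
    · intro I J hIJ hI
      exact le_trans (Nat.cast_le.2 (Finset.card_le_card (Finset.compl_subset_compl.2 hIJ))) hI
    · intro I hI
      exact hQ.meanStay_le_of_card_compl_le (by rwa [Fintype.card_fin])
    · intro J hJ
      rw [Nat.one_le_cast, Nat.one_le_iff_ne_zero, Ne, Finset.card_eq_zero,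
        Finset.compl_eq_empty_iff]
      exact hJ
    · rw [Fintype.card_fin, div_one]
  have hphase2 : ∀ I : Finset (Fin n), η₀ * n < I.card →
      (stepMean (G n) P q)^[logRounds (gap / 4) n]
        (fun J => if ((Jᶜ.card : ℕ) : ℝ) ≤ η₁ * n then 0 else 1) I ≤ ε / 3 := by
    intro I hI
    refine (iterate_stepMean_not_le (A := fun I => η₀ * n < I.card) (x := η₁ * n)
      ?_ hρ₂0 (by positivity) hQ.degree_pos ?_ hI _ ?_).trans (le_trans ?_ hn₂)
    · intro I J hIJ hI
      exact lt_of_lt_of_le hI (Nat.cast_le.2 (Finset.card_le_card hIJ))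
    · intro I hI
      refine hQ.meanStay_le_of_dense (by linarith) hη₁0 ?_
      have := card_add_card_compl_cast I
      rw [Fintype.card_fin] at this ⊢
      linarith
    · intro J hJ
      exact (not_le.1 hJ).le
    · rw [Fintype.card_fin]
      exact le_of_eq (by field_simp)
  set T := logRounds τ₁ n + (logRounds (gap / 4) n + logRounds τ₃ n) with hT
  have hTle : T ≤ ⌊τ * Real.log n⌋₊ := by
    refine Nat.le_floor ?_
    have h1 := logRounds_le hτ₁0.le n
    have h2 := logRounds_le (τ := gap / 4) (by positivity) n
    have h3 := logRounds_le hτ₃0.le n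
    have h4 : 3 ≤ gap / 4 * Real.log n := by
      rw [div_le_iff₀ hgap0] at hlarge
      linarith
    have h5 : τ * Real.log n = τ₁ * Real.log n + gap / 4 * Real.log n + τ₃ * Real.log n +
        gap / 4 * Real.log n := by
      rw [hτ₁, hτ₃, hgap]; ring
    rw [hT]
    push_cast
    linarith
  calc (processLaw (G n) q).real {ω | informed P v ω ⌊τ * Real.log n⌋₊ ≠ Finset.univ}
      ≤ (processLaw (G n) q).real {ω | informed P v ω T ≠ Finset.univ} := by
        refine measureReal_mono fun ω hω hT' => hω ?_
        exact Finset.univ_subset_iff.1 (hT' ▸ informed_mono P v ω hTle)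
    _ = (stepMean (G n) P q)^[T] (fun J => if J = Finset.univ then 0 else 1) {v} := by
        rw [processLaw_real_informed v T fun J => J ≠ Finset.univ]
        simp only [ne_eq, ite_not]
    _ = (stepMean (G n) P q)^[logRounds τ₁ n] ((stepMean (G n) P q)^[logRounds (gap / 4) n]
          ((stepMean (G n) P q)^[logRounds τ₃ n] fun J => if J = Finset.univ then 0 else 1))
            {v} := by
        rw [hT, Function.iterate_add_apply, Function.iterate_add_apply]
    _ ≤ (ε / 3 + ε / 3) + (stepMean (G n) P q)^[logRounds τ₁ n]
          (fun J => if η₀ * n < J.card then 0 else 1) {v} := by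
        have hone : ∀ J, (stepMean (G n) P q)^[logRounds τ₃ n]
            (fun J => if J = Finset.univ then 0 else 1) J ≤ 1 := fun J =>
          iterate_stepMean_le_one (fun J => by split_ifs <;> norm_num) _
        refine iterate_stepMean_le_add (by positivity) (fun J _ => ?_) (fun J _ hJ => ?_) _
        · exact iterate_stepMean_le_one hone _
        · refine (iterate_stepMean_le_add (A := fun J => ((Jᶜ.card : ℕ) : ℝ) ≤ η₁ * n)
            hε3.le (fun J _ => hone J) (fun J _ hJ => hphase3 J hJ) _).trans ?_
          gcongr
          exact hphase2 J hJ
    _ ≤ (ε / 3 + ε / 3) + ε / 3 := by gcongr; exact hn₁ v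
    _ = ε := by ring

/-- It takes at least about `log n / log (1 + c)` rounds to inform half of the vertices. -/
theorem IsExpanderSequence.eventually_half_le (hG : IsExpanderSequence G) (hq : 0 < (q : ℝ))
    {τ ε : ℝ} (hτ0 : 0 < τ) (hτ : τ < 1 / Real.log (1 + growthRate P q)) (hε : 0 < ε) :
    ∀ᶠ n in atTop, ∀ v, (stepMean (G n) P q)^[logRounds τ n]
      (fun J => if (J.card : ℝ) ≤ n / 2 then 0 else 1) {v} ≤ ε := by
  have hlog := log_one_add_growthRate_pos P hq
  have hc := growthRate_pos P hq
  set c := growthRate P q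
  have hlt : 1 + c < Real.exp (1 / τ) := by
    rw [← Real.log_lt_iff_lt_exp (by linarith)]
    rwa [lt_one_div hlog hτ0]
  obtain ⟨η, hη0, hη⟩ : ∃ η : ℝ, 0 < η ∧ 1 + c * (1 + η) < Real.exp (1 / τ) := by
    have hcont : Tendsto (fun η : ℝ => 1 + c * (1 + η)) (𝓝 0) (𝓝 (1 + c)) :=
      Continuous.tendsto' (by fun_prop) _ _ (by simp)
    have h1 := hcont.eventually (eventually_lt_nhds hlt)
    exact ((eventually_mem_nhdsWithin (a := (0 : ℝ)) (s := Set.Ioi 0)).and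
      (h1.filter_mono nhdsWithin_le_nhds)).exists
  set g := 1 + c * (1 + η) with hg
  have hg1 : 1 < g := by
    have : 0 < c * (1 + η) := by positivity
    linarith
  have hκ : 0 < 1 - Real.log g * τ := by
    have h1 : Real.log g < 1 / τ := (Real.log_lt_iff_lt_exp (by linarith)).2 hη
    rw [lt_div_iff₀ hτ0] at h1
    linarith
  have hlim := (tendsto_exp_neg_mul_log hκ).const_mul (2 * g)
  rw [mul_zero] at hlim
  filter_upwards [hlim.eventually (eventually_le_nhds hε), hG.eventually_isQuasirandom hη0,
    eventually_ge_atTop 1] with n hn hQ hn1 v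
  have hn0 : (0 : ℝ) < n := by exact_mod_cast hn1
  refine le_trans ?_ hn
  calc (stepMean (G n) P q)^[logRounds τ n] (fun J => if (J.card : ℝ) ≤ n / 2 then 0 else 1) {v}
      ≤ (stepMean (G n) P q)^[logRounds τ n] (fun J => 2 / n * (J.card : ℝ)) {v} := by
        refine iterate_stepMean_mono _ fun J _ => ?_
        split_ifs with hJ
        · positivity
        · rw [div_mul_eq_mul_div, le_div_iff₀ hn0]
          linarith
    _ = 2 / n * (stepMean (G n) P q)^[logRounds τ n] (fun J => (J.card : ℝ)) {v} :=
        iterate_stepMean_const_mul _ _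
    _ ≤ 2 / n * (g ^ logRounds τ n * ({v} : Finset (Fin n)).card) := by
        gcongr
        exact hQ.iterate_stepMean_card_le _
    _ = 2 * (g ^ logRounds τ n * (1 / n)) := by
        rw [Finset.card_singleton]; ring
    _ ≤ 2 * (Real.exp ((τ * Real.log n + 1) * Real.log g) * Real.exp (-Real.log n)) := by
        have h1 : g ^ logRounds τ n = Real.exp (logRounds τ n * Real.log g) := by
          rw [Real.exp_nat_mul, Real.exp_log (by linarith)]
        have h2 : 1 / (n : ℝ) = Real.exp (-Real.log n) := by
          rw [Real.exp_neg, Real.exp_log hn0, one_div]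
        have h3 := Real.log_pos hg1
        rw [h1, h2]
        gcongr
        exact logRounds_le hτ0.le n
    _ = 2 * (g * Real.exp (-((1 - Real.log g * τ) * Real.log n))) := by
        rw [← Real.exp_add, show (τ * Real.log n + 1) * Real.log g + -Real.log n =
          Real.log g + -((1 - Real.log g * τ) * Real.log n) by ring, Real.exp_add,
          Real.exp_log (by linarith)]
    _ = _ := by ring

/-- If half of the vertices are uninformed, then it takes at least about `log n / (-log ρ)` more
rounds until all vertices are informed. -/
theorem IsExpanderSequence.eventually_univ_le_of_half (hG : IsExpanderSequence G)
    (hq : 0 < (q : ℝ)) {τ ε : ℝ} (hτ0 : 0 < τ) (hρ0 : 0 < shrinkRate P q)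
    (hτ : τ < 1 / -Real.log (shrinkRate P q)) (hε : 0 < ε) :
    ∀ᶠ n in atTop, ∀ I : Finset (Fin n), (I.card : ℝ) ≤ n / 2 →
      (stepMean (G n) P q)^[logRounds τ n] (fun J => if J = Finset.univ then 1 else 0) I ≤ ε := by
  have hρ1 := shrinkRate_lt_one P hq
  have ha := pushRate_mem_Icc P q.2
  have hb := pullRate_mem_Icc P q.2
  have hlρ : 0 < -Real.log (shrinkRate P q) := neg_pos.2 (Real.log_neg hρ0 hρ1)
  have hlt : Real.exp (-(1 / τ)) < shrinkRate P q := by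
    rw [← Real.lt_log_iff_exp_lt hρ0]
    rw [lt_one_div hτ0 hlρ] at hτ
    linarith
  obtain ⟨p₁, hp₁, hp₁ρ⟩ := exists_between hlt
  have hp₁0 : 0 < p₁ := (Real.exp_pos _).trans hp₁
  obtain ⟨η, hη0, hη1, hη⟩ : ∃ η : ℝ, 0 < η ∧ (η < 1 ∧
      p₁ < (1 - pullRate P q) * Real.exp (-(pushRate P q * ((1 + η) / (1 - η))))) := by
    have hcont : ContinuousAt (fun η : ℝ => (1 - pullRate P q) *
        Real.exp (-(pushRate P q * ((1 + η) / (1 - η))))) 0 := by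
      refine continuousAt_const.mul (Real.continuous_exp.continuousAt.comp ?_)
      refine (continuousAt_const.mul ?_).neg
      exact (continuousAt_const.add continuousAt_id).div (continuousAt_const.sub continuousAt_id)
        (by simp)
    have h1 : ∀ᶠ η : ℝ in 𝓝 0, η < 1 ∧
        p₁ < (1 - pullRate P q) * Real.exp (-(pushRate P q * ((1 + η) / (1 - η)))) :=
      (eventually_lt_nhds one_pos).and (hcont.eventually (eventually_gt_nhds (by
        simpa [shrinkRate] using hp₁ρ)))
    exact ((eventually_mem_nhdsWithin (a := (0 : ℝ)) (s := Set.Ioi 0)).and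
      (h1.filter_mono nhdsWithin_le_nhds)).exists
  set p₀ := (1 - pullRate P q) * Real.exp (-(pushRate P q * ((1 + η) / (1 - η)))) with hp₀
  have hp₀1 : p₀ ≤ 1 := by
    refine mul_le_one₀ (by linarith [hb.1]) (Real.exp_pos _).le ?_
    rw [Real.exp_le_one_iff, neg_nonpos]
    have := ha.1
    have : 0 < 1 - η := by linarith
    positivity
  have hκ : 0 < 1 + Real.log p₁ * τ := by
    have h1 : -(1 / τ) < Real.log p₁ := (Real.lt_log_iff_exp_lt hp₁0).2 hp₁
    have h2 : -(1 / τ) * τ < Real.log p₁ * τ := by gcongr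
    rw [neg_mul, one_div_mul_cancel hτ0.ne'] at h2
    linarith
  set κ := 1 + Real.log p₁ * τ with hκdef
  set w := p₀ - p₁
  have hw : 0 < w := sub_pos.2 hη
  have hlim : Tendsto (fun n : ℕ => 2 / (w ^ 2 * p₁) *
      ((τ * Real.log n + 1) * Real.exp (-(κ * Real.log n)))) atTop (𝓝 0) := by
    have h1 : Tendsto (fun x : ℝ => (τ * x + 1) * Real.exp (-(κ * x))) atTop (𝓝 0) := by
      have h2 := (Real.tendsto_pow_mul_exp_neg_atTop_nhds_zero 1).comp
        (tendsto_id.const_mul_atTop hκ)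
      have h3 := (Real.tendsto_pow_mul_exp_neg_atTop_nhds_zero 0).comp
        (tendsto_id.const_mul_atTop hκ)
      have h4 := (h2.const_mul (τ / κ)).add h3
      rw [mul_zero, add_zero] at h4
      refine h4.congr fun x => ?_
      simp only [Function.comp_apply, id, pow_one, pow_zero, one_mul]
      field_simp
    have h5 := (h1.comp tendsto_log_natCast).const_mul (2 / (w ^ 2 * p₁))
    rwa [mul_zero] at h5
  filter_upwards [hlim.eventually (eventually_le_nhds hε), hG.eventually_isQuasirandom hη0,
    eventually_ge_atTop 1] with n hn hQ hn1 I hI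
  have hn0 : (0 : ℝ) < n := by exact_mod_cast hn1
  refine le_trans ?_ hn
  have hIc : (n : ℝ) / 2 ≤ Iᶜ.card := by
    have := card_add_card_compl_cast I
    rw [Fintype.card_fin] at this
    linarith
  set t := logRounds τ n
  have ht : (t : ℝ) ≤ τ * Real.log n + 1 := logRounds_le hτ0.le n
  -- After `t` rounds about `n ^ κ` vertices should be left, which beats the factor `t` in the
  -- failure bound. The extra `p₁` pays for rounding `t` up.
  have hm : p₁ / 2 * Real.exp (κ * Real.log n) ≤ n / 2 * p₁ ^ t := by
    have hp₁log : Real.log p₁ ≤ 0 := Real.log_nonpos hp₁0.le (by linarith)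
    have h1 : p₁ ^ t = Real.exp (t * Real.log p₁) := by
      rw [Real.exp_nat_mul, Real.exp_log hp₁0]
    have h2 : Real.exp ((τ * Real.log n + 1) * Real.log p₁) ≤ Real.exp (t * Real.log p₁) :=
      Real.exp_le_exp.2 (mul_le_mul_of_nonpos_right ht hp₁log)
    calc p₁ / 2 * Real.exp (κ * Real.log n)
        = 1 / 2 * (Real.exp (Real.log n) * Real.exp ((τ * Real.log n + 1) * Real.log p₁)) := by
          nth_rewrite 1 [← Real.exp_log hp₁0]
          rw [div_mul_eq_mul_div, ← Real.exp_add, ← Real.exp_add, hκdef]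
          ring_nf
      _ ≤ 1 / 2 * (n * p₁ ^ t) := by
          rw [Real.exp_log hn0, h1]
          gcongr
      _ = _ := by ring
  refine (iterate_stepMean_eq_univ_le hQ.degree_pos hp₁0 hη hp₀1
    (m := p₁ / 2 * Real.exp (κ * Real.log n)) (by positivity)
    (fun I u _ => hQ.le_stayProb hη1 u) t (hm.trans (by gcongr))).trans ?_
  rw [Real.exp_neg]
  calc (t : ℝ) / (w ^ 2 * (p₁ / 2 * Real.exp (κ * Real.log n)))
      ≤ (τ * Real.log n + 1) / (w ^ 2 * (p₁ / 2 * Real.exp (κ * Real.log n))) := by gcongr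
    _ = _ := by field_simp

theorem IsExpanderSequence.eventually_univ_le (hG : IsExpanderSequence G) (hq : 0 < (q : ℝ))
    {τ ε : ℝ} (hτ : τ < runtimeConst P q) (hε : 0 < ε) :
    ∀ᶠ n in atTop, ∀ v, (processLaw (G n) q).real
      {ω | informed P v ω ⌊τ * Real.log n⌋₊ = Finset.univ} ≤ ε := by
  rw [runtimeConst_eq P q.2.2] at hτ
  have hρ0 := shrinkRate_nonneg P q.2
  have hρ1 := shrinkRate_lt_one P hq
  have hlog := log_one_add_growthRate_pos P hq
  have hA : 0 < 1 / Real.log (1 + growthRate P q) := by positivity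
  have hε2 : 0 < ε / 2 := by positivity
  obtain ⟨τ₁, τ₂, hτ₁0, hτ₁, hττ, hend⟩ : ∃ τ₁ τ₂ : ℝ, 0 < τ₁ ∧
      τ₁ < 1 / Real.log (1 + growthRate P q) ∧ τ ≤ τ₁ + τ₂ ∧
      ∀ᶠ n in atTop, ∀ I : Finset (Fin n), (I.card : ℝ) ≤ n / 2 →
        (stepMean (G n) P q)^[logRounds τ₂ n] (fun J => if J = Finset.univ then 1 else 0) I ≤
          ε / 2 := by
    -- If `ρ = 0`, the second term of the constant is `0`, so informing half of the vertices already
    -- takes long enough and the second phase has no rounds.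
    rcases hρ0.eq_or_lt with h0 | h0
    · rw [← h0, Real.log_zero, neg_zero, div_zero, add_zero] at hτ
      refine ⟨max τ (1 / Real.log (1 + growthRate P q) / 2), 0, lt_max_of_lt_right (by positivity),
        max_lt hτ (by linarith), by rw [add_zero]; exact le_max_left _ _, ?_⟩
      filter_upwards [eventually_ge_atTop 1] with n hn1 I hI
      have hn0 : (0 : ℝ) < n := by exact_mod_cast hn1
      have hI' : I ≠ Finset.univ := by
        rintro rfl
        rw [Finset.card_univ, Fintype.card_fin] at hI
        linarith
      simp [logRounds, hI', hε2.le]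
    · have hB : 0 < 1 / -Real.log (shrinkRate P q) :=
        one_div_pos.2 (neg_pos.2 (Real.log_neg h0 hρ1))
      set A := 1 / Real.log (1 + growthRate P q)
      set B := 1 / -Real.log (shrinkRate P q)
      -- The slack is shared equally between the phases. The maxima keep both lengths positive, as
      -- `τ` may be small or negative.
      refine ⟨max (A - (A + B - τ) / 2) (A / 2), max (B - (A + B - τ) / 2) (B / 2),
        lt_max_of_lt_right (by positivity), max_lt (by linarith) (by linarith), ?_,
        hG.eventually_univ_le_of_half hq (lt_max_of_lt_right (by positivity)) h0
          (max_lt (by linarith : _ < B) (by linarith : _ < B)) hε2⟩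
      have h1 := le_max_left (A - (A + B - τ) / 2) (A / 2)
      have h2 := le_max_left (B - (A + B - τ) / 2) (B / 2)
      linarith
  filter_upwards [hG.eventually_half_le (P := P) hq hτ₁0 hτ₁ hε2, hend] with n hn₁ hn₂ v
  set T := logRounds τ₁ n + logRounds τ₂ n with hT
  have hTle : ⌊τ * Real.log n⌋₊ ≤ T := by
    refine Nat.floor_le_of_le ?_
    have h1 := le_logRounds τ₁ n
    have h2 := le_logRounds τ₂ n
    have h3 := mul_le_mul_of_nonneg_right hττ (Real.log_natCast_nonneg n)
    rw [hT]
    push_cast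
    linarith
  calc (processLaw (G n) q).real {ω | informed P v ω ⌊τ * Real.log n⌋₊ = Finset.univ}
      ≤ (processLaw (G n) q).real {ω | informed P v ω T = Finset.univ} := by
        refine measureReal_mono fun ω (hω : informed P v ω _ = _) => ?_
        exact Finset.univ_subset_iff.1 (hω ▸ informed_mono P v ω hTle)
    _ = (stepMean (G n) P q)^[T] (fun J => if J = Finset.univ then 1 else 0) {v} :=
        processLaw_real_informed v T fun J => J = Finset.univ
    _ = (stepMean (G n) P q)^[logRounds τ₁ n] ((stepMean (G n) P q)^[logRounds τ₂ n]
          fun J => if J = Finset.univ then 1 else 0) {v} := by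
        rw [hT, Function.iterate_add_apply]
    _ ≤ ε / 2 + (stepMean (G n) P q)^[logRounds τ₁ n]
          (fun J => if (J.card : ℝ) ≤ n / 2 then 0 else 1) {v} :=
        iterate_stepMean_le_add hε2.le
          (fun J _ => iterate_stepMean_le_one (fun J => by split_ifs <;> norm_num) _)
          (fun J _ hJ => hn₂ J hJ) _
    _ ≤ ε / 2 + ε / 2 := by gcongr; exact hn₁ v
    _ = ε := by ring

end Bounds

/-! ### From tail bounds to the runtime. -/

theorem runtime_eq_of_isLeast {V : Type*} [Fintype V] [DecidableEq V] {P : Protocol} {v : V}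
    {ω : ℕ → Round V} {t : ℕ} (h : IsLeast {t | informed P v ω t = Finset.univ} t) :
    runtime P v ω = t := by
  refine le_antisymm (iInf₂_le t h.1) (le_iInf₂ fun i hi => ?_)
  exact_mod_cast h.2 hi

theorem exists_runtime_eq {V : Type*} [Fintype V] [DecidableEq V] {P : Protocol} {v : V}
    {ω : ℕ → Round V} {t₀ t₁ : ℕ} (h₀ : informed P v ω t₀ ≠ Finset.univ)
    (h₁ : informed P v ω t₁ = Finset.univ) : ∃ t : ℕ, runtime P v ω = t ∧ t₀ < t ∧ t ≤ t₁ := by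
  classical
  have hex : ∃ t, informed P v ω t = Finset.univ := ⟨t₁, h₁⟩
  refine ⟨Nat.find hex, runtime_eq_of_isLeast ⟨Nat.find_spec hex, fun i hi => Nat.find_min' hex hi⟩,
    ?_, Nat.find_min' hex h₁⟩
  by_contra hle
  refine h₀ (Finset.univ_subset_iff.1 ?_)
  rw [← Nat.find_spec hex]
  exact informed_mono P v ω (not_lt.1 hle)

/-- A monotone family of properties, each of which holds eventually, holds eventually along a
sequence of parameters tending to `0`. -/
theorem exists_tendsto_zero_eventually {D : ℕ → ℝ → Prop}
    (hmono : ∀ n ε ε', ε ≤ ε' → D n ε → D n ε') (hD : ∀ ε > 0, ∀ᶠ n in atTop, D n ε) :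
    ∃ e : ℕ → ℝ, Tendsto e atTop (𝓝 0) ∧ ∀ᶠ n in atTop, D n (e n) := by
  set S : ℕ → Set ℝ := fun n => {ε | 0 < ε ∧ D n ε} with hS
  have hbdd : ∀ n, BddBelow (S n) := fun n => ⟨0, fun ε hε => hε.1.le⟩
  have hnonneg : ∀ n, 0 ≤ sInf (S n) := fun n => Real.sInf_nonneg fun ε hε => hε.1.le
  -- The infimum of the admissible errors need not be attained, hence the vanishing extra term.
  refine ⟨fun n => sInf (S n) + 1 / ((n : ℝ) + 1), ?_, ?_⟩
  · have h1 : Tendsto (fun n => sInf (S n)) atTop (𝓝 0) := by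
      refine tendsto_order.2 ⟨fun a ha => Eventually.of_forall fun n => ha.trans_le (hnonneg n),
        fun a ha => ?_⟩
      filter_upwards [hD (a / 2) (by positivity)] with n hn
      exact (csInf_le (hbdd n) ⟨by positivity, hn⟩).trans_lt (by linarith)
    simpa using h1.add tendsto_one_div_add_atTop_nhds_zero_nat
  · filter_upwards [hD 1 one_pos] with n hn
    obtain ⟨ε, hε, hlt⟩ := Real.lt_sInf_add_pos (s := S n) ⟨1, one_pos, hn⟩
      (ε := 1 / ((n : ℝ) + 1)) (by positivity)
    exact hmono n ε _ hlt.le hε.2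

theorem IsExpanderSequence.eventually_runtime {G : ∀ n : ℕ, SimpleGraph (Fin n)}
    [∀ n, DecidableRel (G n).Adj] (hG : IsExpanderSequence G) {q : unitInterval}
    (hq : 0 < (q : ℝ)) (P : Protocol) {ε : ℝ} (hε : 0 < ε) :
    ∀ᶠ n in atTop, ∀ v, 1 - ENNReal.ofReal ε ≤ processLaw (G n) q
      {ω | ∃ t : ℕ, runtime P v ω = t ∧
        |(t : ℝ) - runtimeConst P q * Real.log n| ≤ ε * Real.log n} := by
  have hε2 : 0 < ε / 2 := by positivity
  have hc : 0 ≤ runtimeConst P q := by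
    rw [runtimeConst_eq P q.2.2]
    exact add_nonneg (one_div_nonneg.2 (log_one_add_growthRate_pos P hq).le)
      (one_div_nonneg.2 (neg_nonneg.2 (Real.log_nonpos (shrinkRate_nonneg P q.2)
        (shrinkRate_lt_one P hq).le)))
  filter_upwards [
    hG.eventually_not_univ_le (P := P) hq (τ := runtimeConst P q + ε) (by linarith) hε2,
    hG.eventually_univ_le (P := P) hq (τ := runtimeConst P q - ε) (by linarith) hε2]
    with n hhi hlo v
  set hi := ⌊(runtimeConst P q + ε) * Real.log n⌋₊
  set lo := ⌊(runtimeConst P q - ε) * Real.log n⌋₊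
  set E := {ω : ℕ → Round (Fin n) | ∃ t : ℕ, runtime P v ω = t ∧
    |(t : ℝ) - runtimeConst P q * Real.log n| ≤ ε * Real.log n}
  have hlog : 0 ≤ Real.log (n : ℝ) := Real.log_natCast_nonneg n
  have hsub : Eᶜ ⊆ {ω | informed P v ω hi ≠ Finset.univ} ∪
      {ω | informed P v ω lo = Finset.univ} := by
    intro ω hω
    by_contra hcon
    rw [Set.mem_union, not_or] at hcon
    obtain ⟨t, ht, hlt, hle⟩ := exists_runtime_eq (t₀ := lo) hcon.2 (not_not.1 hcon.1)
    refine hω ⟨t, ht, abs_le.2 ⟨?_, ?_⟩⟩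
    · have h1 : (runtimeConst P q - ε) * Real.log n < t := by
        refine (Nat.lt_floor_add_one _).trans_le ?_
        exact_mod_cast hlt
      linarith
    · have h1 : (t : ℝ) ≤ (runtimeConst P q + ε) * Real.log n :=
        (Nat.cast_le.2 hle).trans (Nat.floor_le (mul_nonneg (by linarith) hlog))
      linarith
  have hcompl : processLaw (G n) q Eᶜ ≤ ENNReal.ofReal ε := by
    rw [ENNReal.le_ofReal_iff_toReal_le (measure_ne_top _ _) hε.le, ← measureReal_def]
    refine (measureReal_mono hsub).trans ((measureReal_union_le _ _).trans ?_)
    linarith [hhi v, hlo v]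
  rw [tsub_le_iff_right]
  calc (1 : ENNReal) = processLaw (G n) q Set.univ := measure_univ.symm
    _ = processLaw (G n) q (E ∪ Eᶜ) := by rw [Set.union_compl_self]
    _ ≤ processLaw (G n) q E + processLaw (G n) q Eᶜ := measure_union_le _ _
    _ ≤ _ := by gcongr

end RumourSpreading

theorem mainTheorem2 (G : ∀ n : ℕ, SimpleGraph (Fin n)) [∀ n, DecidableRel (G n).Adj]
    (hG : RumourSpreading.IsExpanderSequence G) (q : ℝ) (hq0 : 0 < q) (hq1 : q ≤ 1)
    (P : RumourSpreading.Protocol) :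
    ∃ g : ℕ → ℝ, (g =o[atTop] fun n : ℕ => Real.log n) ∧
      Tendsto
        (fun n : ℕ => ⨅ v : Fin n, RumourSpreading.processLaw (G n) ⟨q, hq0.le, hq1⟩
          {ω | ∃ t : ℕ, RumourSpreading.runtime P v ω = t ∧
            |(t : ℝ) - RumourSpreading.runtimeConst P q * Real.log n| ≤ g n})
        atTop (𝓝 1) := by
  obtain ⟨e, he, hD⟩ := RumourSpreading.exists_tendsto_zero_eventually
    (D := fun n ε => ∀ v, 1 - ENNReal.ofReal ε ≤
      RumourSpreading.processLaw (G n) ⟨q, hq0.le, hq1⟩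
        {ω | ∃ t : ℕ, RumourSpreading.runtime P v ω = t ∧
          |(t : ℝ) - RumourSpreading.runtimeConst P q * Real.log n| ≤ ε * Real.log n})
    (fun n ε ε' hle h v => by
      refine (tsub_le_tsub_left (ENNReal.ofReal_le_ofReal hle) 1).trans ((h v).trans ?_)
      refine measure_mono fun ω ⟨t, ht, hb⟩ => ⟨t, ht, hb.trans ?_⟩
      exact mul_le_mul_of_nonneg_right hle (Real.log_natCast_nonneg n))
    (fun ε hε => hG.eventually_runtime (q := ⟨q, hq0.le, hq1⟩) hq0 P hε)
  refine ⟨fun n => e n * Real.log n, ?_, ?_⟩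
  · simpa using ((isLittleO_one_iff ℝ).2 he).mul_isBigO
      (isBigO_refl (fun n : ℕ => Real.log n) atTop)
  · have hlow : Tendsto (fun n => 1 - ENNReal.ofReal (e n)) atTop (𝓝 1) := by
      have h1 : Tendsto (fun n => ENNReal.ofReal (e n)) atTop (𝓝 0) := by
        simpa using ENNReal.tendsto_ofReal he
      simpa using ENNReal.Tendsto.sub tendsto_const_nhds h1 (Or.inl ENNReal.one_ne_top)
    refine tendsto_of_tendsto_of_tendsto_of_le_of_le' hlow tendsto_const_nhds ?_ ?_
    · filter_upwards [hD] with n hn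
      exact le_iInf hn
    -- For `n = 0` the infimum over no vertices would be `⊤`.
    · filter_upwards [eventually_ge_atTop 1] with n hn
      exact (iInf_le _ (⟨0, hn⟩ : Fin n)).trans prob_le_one
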